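/- Let $(M_0,g_0)$ and $(M_1,g_1)$ be smooth Riemannian manifolds of dimension $n\ge 1$ with boundaries, let $\Gamma$ be a compact smooth $(n-1)$-manifold smoothly embedded in $M_0$ and in $M_1$ with image $\partial M_0$, respectively $\partial M_1$, such that $g_0$ and $g_1$ induce the same metric on $\Gamma$ (so $M_0$ and $M_1$ are glued along an isometry of their boundaries). Fermi coordinates $(x^1,\dots,x^n)$ of $M_i$ near $\Gamma$ are given by $x^n(p)=d(p,\Gamma)$ and by $(x^1,\dots,x^{n-1})(p)=$ the coordinates, in a chart of $\Gamma$, of the point of $\Gamma$ closest to $p$; the $x^n$-lines are the unit speed geodesics leaving $\Gamma$ orthogonally. Put $N=\partial_n$, let $\mathbf P^N,\mathbf P^T$ be the projections onto $\mathbb RN$ and onto the span of $\partial_1,\dots,\partial_{n-1}$. Write $\langle\cdot,\cdot\rangle=g_0$, and let $\nabla$ and $R$ be the Levi-Civita connection and the curvature tensor of $g_0$, with the sign such that $R_{ijij}$ is the sectional curvature for orthonormal $e_i,e_j$. Let $L=L_0+L_1$ be the sum of the second fundamental forms of $\Gamma$ in $M_0$ and $M_1$ with respect to the inward normals, $L_i(X,Y)=-\langle\nabla_XN,Y\rangle_i$.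 On an open neighborhood $U$ of $\Gamma$ in $M_0$ let $\mathbf L$ be the smooth self-adjoint endomorphism field with $\langle X,\mathbf LY\rangle=L(X,Y)$ for $X,Y\in T\Gamma$, $\mathbf LN=0$ and $\nabla_N\mathbf L=0$. For $0<\delta<\delta_{\max}$ let $f_\delta\in C^\infty([0,\infty))$ satisfy $f_\delta(x)=1-x/\delta^4$ on $[0,\delta^4]$; $-\delta^2\le f_\delta\le0$ and $f_\delta'\le\delta$ on $[\delta^4,\delta]$; $f_\delta=0$ on $[\delta,\infty)$; $\int_0^\delta f_\delta=0$. Put $F_\delta(x)=\int_0^xf_\delta$, $\mathcal F_\delta(x)=\int_0^xF_\delta$. For a constant $C\in\mathbb R$ let $$g_\delta=\langle\cdot,\mathbf G_\delta\cdot\rangle,\qquad \mathbf G_\delta=\mathbf I+2F_\delta(x^n)\mathbf L-2C\mathcal F_\delta(x^n)\mathbf P^T .$$ On two-vectors (antisymmetric elements of $TM_0\otimes TM_0$, $v\wedge w=v\otimes w-w\otimes v$) let $\mathcal I(e_i\wedge e_j,e_k\wedge e_l)=g_{ik}g_{jl}-g_{jk}g_{il}$ with $g=g_0$. A bilinear form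 $\mathcal T(e_i\wedge e_j,e_k\wedge e_l)=T_{ijkl}$ on two-vectors is identified with the operator $\mathcal T$ given by $\mathcal I(\cdot,\mathcal T\cdot)=\mathcal T(\cdot,\cdot)$. In this way the curvature tensors $R$ of $g_0$ and $R^\delta$ of $g_\delta$ define operators $\mathcal R$ and $\mathcal R_\delta$ (for both, the form is turned into an operator by means of the fixed metric $g_0$). For endomorphisms $\mathbf A,\mathbf B$ let $(\mathbf A\wedge\mathbf B)(v\wedge w)=\frac12(\mathbf Av\wedge\mathbf Bw+\mathbf Bv\wedge\mathbf Aw)$, and let $\nabla N$ be the endomorphism $X\mapsto\nabla_XN$. Let $\mathcal B$ be the operator of the tensor $$\begin{aligned}B_{ijkl}=&-2(\mathbf L\wedge\nabla N)_{ijkl}\\&+\langle\partial_i,(\nabla_{\partial_j}\mathbf L)\partial_l\rangle\langle\partial_k,N\rangle-\langle\partial_j,(\nabla_{\partial_i}\mathbf L)\partial_l\rangle\langle\partial_k,N\rangle\\&-\langle\partial_i,(\nabla_{\partial_j}\mathbf L)\partial_k\rangle\langle\partial_l,N\rangle+\langle\partial_j,(\nabla_{\partial_i}\mathbf L)\partial_k\rangle\langle\partial_l,N\rangle\\&+\langle\partial_k,(\nabla_{\partial_l}\mathbf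 L)\partial_j\rangle\langle\partial_i,N\rangle-\langle\partial_l,(\nabla_{\partial_k}\mathbf L)\partial_j\rangle\langle\partial_i,N\rangle\\&-\langle\partial_k,(\nabla_{\partial_l}\mathbf L)\partial_i\rangle\langle\partial_j,N\rangle+\langle\partial_l,(\nabla_{\partial_k}\mathbf L)\partial_i\rangle\langle\partial_j,N\rangle .\end{aligned}$$ Then $\mathcal B$ is smooth, and on the domain of every Fermi coordinate chart of $M_0$ contained in $U$ $$\mathcal R_\delta\approx\mathcal R-f_\delta^2\,\mathbf L\wedge\mathbf L+f_\delta\,\mathcal B-2f_\delta'\,\mathbf L\wedge\mathbf P^N+2f_\delta^2\,\mathbf L^2\wedge\mathbf P^N+2Cf_\delta\,\mathbf P^T\wedge\mathbf P^N ,$$ where $f_\delta,f_\delta'$ are evaluated at $x^n$. Here $\mathcal S_\delta\approx\mathcal T_\delta$ means: both sides are self-adjoint with respect to $\mathcal I$, they are equal at the points of $\Gamma$ (for every $\delta<\delta_{\max}$), and all eigenvalues of $\mathcal S_\delta-\mathcal T_\delta$ tend to zero as $\delta\to0$, uniformly on compact subsets. -/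

import Mathlib

open Set Manifold Bundle
open scoped ContDiff ENNReal

/-! ### Two-vectors, bilinear forms and operators on them, in a frame `∂₀, …, ∂ₙ₋₁`

A bilinear form `A` on the tangent space is recorded by its matrix `A i j = A(∂ᵢ, ∂ⱼ)`, an
endomorphism `𝐀` by `𝐀 ∂ⱼ = ∑ᵢ 𝐀 i j ∂ᵢ`; for a metric with matrix `g`, the form
`A(v, w) = ⟨v, 𝐀 w⟩` has matrix `g * 𝐀`. -/

namespace Gluing

/-- Two-vectors: antisymmetric `α ∈ V ⊗ V`, that is `α = ∑ αⁱʲ ∂ᵢ ⊗ ∂ⱼ` with `αⁱʲ = -αʲⁱ`. -/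
def TwoVector (n : ℕ) : Submodule ℝ (Matrix (Fin n) (Fin n) ℝ) where
  carrier := {α | α.transpose = -α}
  add_mem' := by
    intro a b ha hb
    simp only [mem_ofPred_eq] at *
    rw [Matrix.transpose_add, ha, hb]
    abel
  zero_mem' := by simp
  smul_mem' := by
    intro c a ha
    simp only [mem_ofPred_eq] at *
    rw [Matrix.transpose_smul, ha, smul_neg]

/-- The bilinear form on two-vectors with `𝒯(∂ᵢ ∧ ∂ⱼ, ∂ₖ ∧ ∂ₗ) = T i j k l`, for a `(0,4)`-tensor `T`
antisymmetric in `i, j` and in `k, l`. -/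
noncomputable def tensorForm {n : ℕ} (T : Fin n → Fin n → Fin n → Fin n → ℝ)
    (α β : TwoVector n) : ℝ :=
  (1 / 4) * ∑ i, ∑ j, ∑ k, ∑ l, T i j k l * α.1 i j * β.1 k l

/-- The inner product `ℐ` on two-vectors induced by the metric `g`. -/
noncomputable def twoVectorInner {n : ℕ} (g : Matrix (Fin n) (Fin n) ℝ) (α β : TwoVector n) : ℝ :=
  tensorForm (fun i j k l => g i k * g j l - g j k * g i l) α β

/-- The contraction `∑ T i j k l βᵏˡ` (over `k, l`). -/
noncomputable def contractRight {n : ℕ} (T : Fin n → Fin n → Fin n → Fin n → ℝ)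
    (β : Matrix (Fin n) (Fin n) ℝ) : Matrix (Fin n) (Fin n) ℝ :=
  Matrix.of fun i j => ∑ k, ∑ l, T i j k l * β k l

/-- The operator `𝒯` on two-vectors with `ℐ(α, 𝒯 β) = 𝒯(α, β)` (see `twoVectorInner_opOf`). -/
noncomputable def opOf {n : ℕ} (g : Matrix (Fin n) (Fin n) ℝ)
    (T : Fin n → Fin n → Fin n → Fin n → ℝ) : TwoVector n →ₗ[ℝ] TwoVector n where
  toFun β := ⟨(1 / 4 : ℝ) •
      (g⁻¹ * (contractRight T β.1 - (contractRight T β.1).transpose) * g⁻¹.transpose), by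
    show Matrix.transpose _ = - _
    rw [Matrix.transpose_smul, Matrix.transpose_mul, Matrix.transpose_mul,
      Matrix.transpose_transpose, Matrix.transpose_sub, Matrix.transpose_transpose, ← smul_neg,
      ← Matrix.mul_assoc, ← Matrix.neg_mul, ← Matrix.mul_neg, neg_sub]⟩
  map_add' β γ := by
    have h : contractRight T (β.1 + γ.1) = contractRight T β.1 + contractRight T γ.1 := by
      ext i j
      simp only [contractRight, Matrix.of_apply, Matrix.add_apply, mul_add,
        Finset.sum_add_distrib]
    apply Subtype.ext
    simp only [Submodule.coe_add, h, Matrix.transpose_add]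
    rw [← smul_add, ← Matrix.add_mul, ← Matrix.mul_add]
    congr 3
    abel
  map_smul' r β := by
    have h : contractRight T (r • β.1) = r • contractRight T β.1 := by
      ext i j
      simp only [contractRight, Matrix.of_apply, Matrix.smul_apply, smul_eq_mul, Finset.mul_sum]
      exact Finset.sum_congr rfl fun k _ => Finset.sum_congr rfl fun l _ => by ring
    apply Subtype.ext
    simp only [SetLike.val_smul, h, Matrix.transpose_smul, RingHom.id_apply]
    rw [← smul_sub, Matrix.mul_smul, Matrix.smul_mul, smul_comm]

/-- The Kulkarni–Nomizu product of two endomorphisms,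
`(𝐀 ∧ 𝐁)(v ∧ w) = ½ (𝐀 v ∧ 𝐁 w + 𝐁 v ∧ 𝐀 w)`, where `v ∧ w = v ⊗ w - w ⊗ v`. -/
noncomputable def kulkarniNomizu {n : ℕ} (A B : Matrix (Fin n) (Fin n) ℝ) :
    TwoVector n →ₗ[ℝ] TwoVector n where
  toFun α := ⟨(1 / 2 : ℝ) • (A * α.1 * B.transpose + B * α.1 * A.transpose), by
    have h : α.1.transpose = -α.1 := α.2
    show Matrix.transpose _ = - _
    simp only [Matrix.transpose_smul, Matrix.transpose_add, Matrix.transpose_mul,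
      Matrix.transpose_transpose, h, ← Matrix.mul_assoc, Matrix.mul_neg, Matrix.neg_mul]
    rw [← smul_neg, neg_add, add_comm]⟩
  map_add' α β := by
    apply Subtype.ext
    simp only [Submodule.coe_add, Matrix.mul_add, Matrix.add_mul, smul_add]
    abel
  map_smul' c α := by
    apply Subtype.ext
    simp only [SetLike.val_smul, Matrix.mul_smul, Matrix.smul_mul, RingHom.id_apply, ← smul_add]
    rw [smul_comm]

/-- `v ∧ w = v ⊗ w - w ⊗ v`. -/
def wedge {n : ℕ} (v w : Fin n → ℝ) : TwoVector n :=
  ⟨Matrix.vecMulVec v w - Matrix.vecMulVec w v, by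
    show Matrix.transpose _ = - _
    rw [Matrix.transpose_sub, Matrix.transpose_vecMulVec, Matrix.transpose_vecMulVec, neg_sub]⟩

theorem kulkarniNomizu_wedge {n : ℕ} (A B : Matrix (Fin n) (Fin n) ℝ) (v w : Fin n → ℝ) :
    kulkarniNomizu A B (wedge v w) = (1 / 2 : ℝ) •
      (wedge (A.mulVec v) (B.mulVec w) + wedge (B.mulVec v) (A.mulVec w)) := by
  apply Subtype.ext
  simp only [kulkarniNomizu, wedge, LinearMap.coe_mk, AddHom.coe_mk, SetLike.val_smul,
    Submodule.coe_add, Matrix.mul_sub, Matrix.sub_mul, Matrix.mul_vecMulVec,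
    Matrix.vecMulVec_mul, Matrix.vecMul_transpose]
  congr 1
  abel

theorem twoVectorInner_opOf {n : ℕ} (g : Matrix (Fin n) (Fin n) ℝ) (hg : g.det ≠ 0)
    (T : Fin n → Fin n → Fin n → Fin n → ℝ) (α β : TwoVector n) :
    twoVectorInner g α (opOf g T β) = tensorForm T α β := by
  set P : Matrix (Fin n) (Fin n) ℝ := contractRight T β.1 with hP
  have hu : IsUnit g.det := isUnit_iff_ne_zero.mpr hg
  have hγ : (opOf g T β).1 = (1 / 4 : ℝ) • (g⁻¹ * (P - P.transpose) * g⁻¹.transpose) := rfl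
  have hQ : g * (opOf g T β).1 * g.transpose = (1 / 4 : ℝ) • (P - P.transpose) := by
    rw [hγ, Matrix.mul_smul, Matrix.smul_mul, ← Matrix.mul_assoc, ← Matrix.mul_assoc,
      Matrix.mul_nonsing_inv g hu, Matrix.one_mul, Matrix.mul_assoc, ← Matrix.transpose_mul,
      Matrix.mul_nonsing_inv g hu, Matrix.transpose_one, Matrix.mul_one]
  have hα : ∀ i j, α.1 j i = -α.1 i j := fun i j => congrFun (congrFun α.2 i) j
  have hQ' : ∀ i j, ∑ k, ∑ l, g i k * g j l * (opOf g T β).1 k l =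
      (1 / 4) * (P i j - P j i) := by
    intro i j
    have := congrFun (congrFun hQ i) j
    simp only [Matrix.mul_apply, Matrix.transpose_apply, Finset.sum_mul, Matrix.smul_apply,
      Matrix.sub_apply, smul_eq_mul] at this
    rw [← this, Finset.sum_comm]
    exact Finset.sum_congr rfl fun a _ => Finset.sum_congr rfl fun b _ => by ring
  have hswap : ∑ i, ∑ j, α.1 i j * P j i = -∑ i, ∑ j, α.1 i j * P i j := by
    rw [Finset.sum_comm, ← Finset.sum_neg_distrib]
    refine Finset.sum_congr rfl fun i _ => ?_
    rw [← Finset.sum_neg_distrib]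
    exact Finset.sum_congr rfl fun j _ => by rw [hα i j]; ring
  have hR : tensorForm T α β = (1 / 4) * ∑ i, ∑ j, α.1 i j * P i j := by
    unfold tensorForm
    congr 1
    refine Finset.sum_congr rfl fun i _ => Finset.sum_congr rfl fun j _ => ?_
    rw [hP, contractRight, Matrix.of_apply, Finset.mul_sum]
    refine Finset.sum_congr rfl fun k _ => ?_
    rw [Finset.mul_sum]
    exact Finset.sum_congr rfl fun l _ => by ring
  have hS : twoVectorInner g α (opOf g T β) =
      (1 / 4) * ∑ i, ∑ j, α.1 i j * ((1 / 2) * (P i j - P j i)) := by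
    unfold twoVectorInner tensorForm
    congr 1
    refine Finset.sum_congr rfl fun i _ => Finset.sum_congr rfl fun j _ => ?_
    have h : (1 / 2 : ℝ) * (P i j - P j i) =
        ∑ k, ∑ l, g i k * g j l * (opOf g T β).1 k l -
          ∑ k, ∑ l, g j k * g i l * (opOf g T β).1 k l := by
      rw [hQ' i j, hQ' j i]
      ring
    rw [h, ← Finset.sum_sub_distrib, Finset.mul_sum]
    refine Finset.sum_congr rfl fun k _ => ?_
    rw [← Finset.sum_sub_distrib, Finset.mul_sum]
    exact Finset.sum_congr rfl fun l _ => by ring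
  rw [hS, hR]
  congr 1
  have : ∑ i, ∑ j, α.1 i j * ((1 / 2) * (P i j - P j i)) =
      (1 / 2) * (∑ i, ∑ j, α.1 i j * P i j - ∑ i, ∑ j, α.1 i j * P j i) := by
    rw [← Finset.sum_sub_distrib, Finset.mul_sum]
    refine Finset.sum_congr rfl fun i _ => ?_
    rw [← Finset.sum_sub_distrib, Finset.mul_sum]
    exact Finset.sum_congr rfl fun j _ => by ring
  rw [this, hswap]
  ring

/-- Self-adjointness with respect to `ℐ`. -/
def IsSelfAdjointFor {n : ℕ} (g : Matrix (Fin n) (Fin n) ℝ)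
    (S : TwoVector n →ₗ[ℝ] TwoVector n) : Prop :=
  ∀ α β, twoVectorInner g α (S β) = twoVectorInner g (S α) β

/-! ### Metrics, Christoffel symbols and curvature in a chart of a manifold with boundary

Charts take values in the half-space `{x₀ ≥ 0}`; the index `0` is the normal direction. -/

/-- The coordinate half-space. -/
def halfSpace (m : ℕ) : Set (EuclideanSpace ℝ (Fin (m + 1))) := {x | 0 ≤ x 0}

/-- The partial derivative `∂ᵢ u` on the half-space (one-sided on the boundary). -/
noncomputable def pd {m : ℕ} (i : Fin (m + 1)) (u : EuclideanSpace ℝ (Fin (m + 1)) → ℝ)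
    (x : EuclideanSpace ℝ (Fin (m + 1))) : ℝ :=
  fderivWithin ℝ u (halfSpace m) x (EuclideanSpace.single i 1)

/-- The Christoffel symbol `Γᵏᵢⱼ` of the metric with coefficients `g`. -/
noncomputable def christoffel {m : ℕ}
    (g : EuclideanSpace ℝ (Fin (m + 1)) → Matrix (Fin (m + 1)) (Fin (m + 1)) ℝ)
    (x : EuclideanSpace ℝ (Fin (m + 1))) (k i j : Fin (m + 1)) : ℝ :=
  (1 / 2) * ∑ l, (g x)⁻¹ k l *
    (pd i (fun y => g y j l) x + pd j (fun y => g y i l) x - pd l (fun y => g y i j) x)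

/-- The curvature tensor `Rᵢⱼₖₗ` of the metric with coefficients `g`, with the sign for which
`Rᵢⱼᵢⱼ` is the sectional curvature when `∂ᵢ, ∂ⱼ` are orthonormal. -/
noncomputable def riemann {m : ℕ}
    (g : EuclideanSpace ℝ (Fin (m + 1)) → Matrix (Fin (m + 1)) (Fin (m + 1)) ℝ)
    (x : EuclideanSpace ℝ (Fin (m + 1))) (i j k l : Fin (m + 1)) : ℝ :=
  (1 / 2) * (pd j (pd k (fun y => g y i l)) x + pd i (pd l (fun y => g y j k)) x
      - pd i (pd k (fun y => g y j l)) x - pd j (pd l (fun y => g y i k)) x)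
    + ∑ p, ∑ q, g x p q * (christoffel g x p j k * christoffel g x q i l
      - christoffel g x p i k * christoffel g x q j l)

/-- The component `((∇_{∂ᵢ} 𝐀) ∂ₗ)ᵏ` of the covariant derivative of an endomorphism field. -/
noncomputable def covDerivEnd {m : ℕ}
    (g A : EuclideanSpace ℝ (Fin (m + 1)) → Matrix (Fin (m + 1)) (Fin (m + 1)) ℝ)
    (x : EuclideanSpace ℝ (Fin (m + 1))) (i k l : Fin (m + 1)) : ℝ :=
  pd i (fun y => A y k l) x + ∑ p, christoffel g x k i p * A x p l
    - ∑ p, christoffel g x p i l * A x k p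

/-- The endomorphism `∇N : X ↦ ∇_X N`, where `N = ∂₀`. -/
noncomputable def nablaN {m : ℕ}
    (g : EuclideanSpace ℝ (Fin (m + 1)) → Matrix (Fin (m + 1)) (Fin (m + 1)) ℝ)
    (x : EuclideanSpace ℝ (Fin (m + 1))) : Matrix (Fin (m + 1)) (Fin (m + 1)) ℝ :=
  Matrix.of fun k i => christoffel g x k i 0

/-- The second fundamental form `-⟨∇_{∂ᵢ} N, ∂ⱼ⟩` of the slices `x₀ = const`, where `N = ∂₀`. On the
boundary `N` is the inward normal. -/
noncomputable def secondFundamentalForm {m : ℕ}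
    (g : EuclideanSpace ℝ (Fin (m + 1)) → Matrix (Fin (m + 1)) (Fin (m + 1)) ℝ)
    (x : EuclideanSpace ℝ (Fin (m + 1))) (i j : Fin (m + 1)) : ℝ :=
  -∑ k, nablaN g x k i * g x k j

/-- The projection `𝐏ᴺ` onto `ℝ ∂₀`. -/
def projN (m : ℕ) : Matrix (Fin (m + 1)) (Fin (m + 1)) ℝ :=
  Matrix.diagonal fun i => if i = 0 then 1 else 0

/-- The projection `𝐏ᵀ` onto the span of `∂₁, …, ∂ₘ`. -/
def projT (m : ℕ) : Matrix (Fin (m + 1)) (Fin (m + 1)) ℝ :=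
  Matrix.diagonal fun i => if i = 0 then 0 else 1

/-! ### Coefficients of the metric and of endomorphism fields in a chart -/

section Charts

variable {m : ℕ} {M : Type*}

/-- The coordinate vector `∂ᵢ` at the point with coordinates `x`. -/
noncomputable def coordVec [TopologicalSpace M] [ChartedSpace (EuclideanHalfSpace (m + 1)) M]
    (e : OpenPartialHomeomorph M (EuclideanHalfSpace (m + 1)))
    (x : EuclideanSpace ℝ (Fin (m + 1))) (i : Fin (m + 1)) :
    TangentSpace (𝓡∂ (m + 1)) ((e.extend (𝓡∂ (m + 1))).symm x) :=
  mfderivWithin 𝓘(ℝ, EuclideanSpace ℝ (Fin (m + 1))) (𝓡∂ (m + 1))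
    (e.extend (𝓡∂ (m + 1))).symm (halfSpace m) x
      (EuclideanSpace.single i (1 : ℝ) : EuclideanSpace ℝ (Fin (m + 1)))

/-- The coefficients `gᵢⱼ = ⟨∂ᵢ, ∂ⱼ⟩` of the Riemannian metric of `M`. -/
noncomputable def metricCoeff [TopologicalSpace M] [ChartedSpace (EuclideanHalfSpace (m + 1)) M]
    [RiemannianBundle (fun p : M => TangentSpace (𝓡∂ (m + 1)) p)]
    (e : OpenPartialHomeomorph M (EuclideanHalfSpace (m + 1)))
    (x : EuclideanSpace ℝ (Fin (m + 1))) : Matrix (Fin (m + 1)) (Fin (m + 1)) ℝ :=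
  Matrix.of fun i j => inner ℝ (coordVec e x i) (coordVec e x j)

/-- The components `vⁱ` of a tangent vector `v = ∑ᵢ vⁱ ∂ᵢ` at `p`. -/
noncomputable def coordComp [TopologicalSpace M] [ChartedSpace (EuclideanHalfSpace (m + 1)) M]
    (e : OpenPartialHomeomorph M (EuclideanHalfSpace (m + 1))) (p : M)
    (v : TangentSpace (𝓡∂ (m + 1)) p) : EuclideanSpace ℝ (Fin (m + 1)) :=
  mfderiv (𝓡∂ (m + 1)) 𝓘(ℝ, EuclideanSpace ℝ (Fin (m + 1))) (e.extend (𝓡∂ (m + 1))) p v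

/-- The coefficients of an endomorphism field: `𝐀 ∂ⱼ = ∑ᵢ 𝐀 i j ∂ᵢ`. -/
noncomputable def endCoeff [TopologicalSpace M] [ChartedSpace (EuclideanHalfSpace (m + 1)) M]
    (e : OpenPartialHomeomorph M (EuclideanHalfSpace (m + 1)))
    (A : ∀ p : M, TangentSpace (𝓡∂ (m + 1)) p →L[ℝ] TangentSpace (𝓡∂ (m + 1)) p)
    (x : EuclideanSpace ℝ (Fin (m + 1))) : Matrix (Fin (m + 1)) (Fin (m + 1)) ℝ :=
  Matrix.of fun i j =>
    coordComp e ((e.extend (𝓡∂ (m + 1))).symm x)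
      (A ((e.extend (𝓡∂ (m + 1))).symm x) (coordVec e x j)) i

/-- The point `(t, y)` of `ℝ × ℝᵐ = ℝᵐ⁺¹`. -/
noncomputable def consPt (t : ℝ) (y : EuclideanSpace ℝ (Fin m)) :
    EuclideanSpace ℝ (Fin (m + 1)) :=
  WithLp.toLp 2 (Fin.cons t fun i => y i)

/-- The last `m` coordinates of a point of `ℝᵐ⁺¹`. -/
noncomputable def tailPt (x : EuclideanSpace ℝ (Fin (m + 1))) : EuclideanSpace ℝ (Fin m) :=
  WithLp.toLp 2 fun i => x i.succ

/-- `e` is a chart of Fermi coordinates of `M` over the chart `c` of its boundary `Γ`, which is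
embedded by `ι`: the normal coordinate of `p` is the distance of `p` to `Γ`, the other coordinates
are those of the point of `Γ` closest to `p`, and the normal coordinate lines are the unit speed
geodesics that leave `Γ` orthogonally. -/
structure IsFermiChart {Γ : Type*} [TopologicalSpace Γ] [ChartedSpace (EuclideanSpace ℝ (Fin m)) Γ]
    [EMetricSpace M] [ChartedSpace (EuclideanHalfSpace (m + 1)) M]
    [RiemannianBundle (fun p : M => TangentSpace (𝓡∂ (m + 1)) p)]
    (ι : Γ → M) (c : OpenPartialHomeomorph Γ (EuclideanSpace ℝ (Fin m)))
    (e : OpenPartialHomeomorph M (EuclideanHalfSpace (m + 1))) : Prop where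
  base_mem : c ∈ IsManifold.maximalAtlas (𝓡 m) ∞ Γ
  chart_mem : e ∈ IsManifold.maximalAtlas (𝓡∂ (m + 1)) ∞ M
  closest : ∀ p ∈ e.source, ∃ q ∈ c.source, ι q ∈ e.source ∧
    e.extend (𝓡∂ (m + 1)) (ι q) = consPt 0 (c q) ∧
    tailPt (e.extend (𝓡∂ (m + 1)) p) = c q ∧
    ENNReal.ofReal (e.extend (𝓡∂ (m + 1)) p 0) = Metric.infEDist p (range ι) ∧
    edist p (ι q) = Metric.infEDist p (range ι)
  segment : ∀ x ∈ (e.extend (𝓡∂ (m + 1))).target, ∀ t ∈ Icc 0 (x 0),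
    consPt t (tailPt x) ∈ (e.extend (𝓡∂ (m + 1))).target
  unitSpeed : ∀ x ∈ (e.extend (𝓡∂ (m + 1))).target, metricCoeff e x 0 0 = 1
  geodesic : ∀ x ∈ (e.extend (𝓡∂ (m + 1))).target, ∀ k, christoffel (metricCoeff e) x k 0 0 = 0
  orthogonal : ∀ x ∈ (e.extend (𝓡∂ (m + 1))).target, x 0 = 0 →
    ∀ i : Fin m, metricCoeff e x 0 i.succ = 0

/-- `𝐋` is the operator on `TM₀` near `Γ` determined by the second fundamental forms of `Γ` in `M₀`
and `M₁`: on `TΓ` it represents their sum (with respect to the inward normals), and it is extended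
to the neighborhood `U` of `Γ` by `𝐋 N = 0` and `∇_N 𝐋 = 0`. -/
structure IsGluingOperator {Γ M₀ M₁ : Type*} [TopologicalSpace Γ]
    [ChartedSpace (EuclideanSpace ℝ (Fin m)) Γ]
    [EMetricSpace M₀] [ChartedSpace (EuclideanHalfSpace (m + 1)) M₀]
    [RiemannianBundle (fun p : M₀ => TangentSpace (𝓡∂ (m + 1)) p)]
    [EMetricSpace M₁] [ChartedSpace (EuclideanHalfSpace (m + 1)) M₁]
    [RiemannianBundle (fun p : M₁ => TangentSpace (𝓡∂ (m + 1)) p)]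
    (ι₀ : Γ → M₀) (ι₁ : Γ → M₁) (U : Set M₀)
    (L : ∀ p : M₀, TangentSpace (𝓡∂ (m + 1)) p →L[ℝ] TangentSpace (𝓡∂ (m + 1)) p) : Prop where
  selfAdjoint : ∀ p ∈ U, ∀ v w : TangentSpace (𝓡∂ (m + 1)) p,
    inner ℝ (L p v) w = inner ℝ v (L p w)
  smooth : ∀ c e, IsFermiChart ι₀ c e → e.source ⊆ U → ∀ i j,
    ContDiffOn ℝ ∞ (fun x => endCoeff e L x i j) (e.extend (𝓡∂ (m + 1))).target
  boundary : ∀ c e₀ e₁, IsFermiChart ι₀ c e₀ → IsFermiChart ι₁ c e₁ → e₀.source ⊆ U →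
    ∀ y : EuclideanSpace ℝ (Fin m), consPt 0 y ∈ (e₀.extend (𝓡∂ (m + 1))).target →
      consPt 0 y ∈ (e₁.extend (𝓡∂ (m + 1))).target → ∀ i j : Fin m,
        (metricCoeff e₀ (consPt 0 y) * endCoeff e₀ L (consPt 0 y)) i.succ j.succ =
          secondFundamentalForm (metricCoeff e₀) (consPt 0 y) i.succ j.succ +
            secondFundamentalForm (metricCoeff e₁) (consPt 0 y) i.succ j.succ
  normal : ∀ c e, IsFermiChart ι₀ c e → e.source ⊆ U →
    ∀ x ∈ (e.extend (𝓡∂ (m + 1))).target, ∀ k, endCoeff e L x k 0 = 0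
  parallel : ∀ c e, IsFermiChart ι₀ c e → e.source ⊆ U →
    ∀ x ∈ (e.extend (𝓡∂ (m + 1))).target, ∀ k l,
      covDerivEnd (metricCoeff e) (endCoeff e L) x 0 k l = 0

end Charts

/-! ### The auxiliary functions, the modified metric and the operators -/

/-- The family of smooth functions `f_δ` on `[0, ∞)`, `0 < δ < δmax`. -/
structure IsAuxFamily (δmax : ℝ) (f : ℝ → ℝ → ℝ) : Prop where
  smooth : ∀ δ ∈ Ioo 0 δmax, ContDiffOn ℝ ∞ (f δ) (Ici 0)
  linear : ∀ δ ∈ Ioo 0 δmax, ∀ x ∈ Icc 0 (δ ^ 4), f δ x = 1 - x / δ ^ 4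
  small : ∀ δ ∈ Ioo 0 δmax, ∀ x ∈ Icc (δ ^ 4) δ, -δ ^ 2 ≤ f δ x ∧ f δ x ≤ 0
  slope : ∀ δ ∈ Ioo 0 δmax, ∀ x ∈ Icc (δ ^ 4) δ, derivWithin (f δ) (Ici 0) x ≤ δ
  vanish : ∀ δ ∈ Ioo 0 δmax, ∀ x ∈ Ici δ, f δ x = 0
  mean : ∀ δ ∈ Ioo 0 δmax, ∫ t in (0 : ℝ)..δ, f δ t = 0

/-- `F_δ(x) = ∫₀ˣ f_δ`, and, applied to `F_δ`, the function `ℱ_δ`. -/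
noncomputable def primitive (f : ℝ → ℝ) (x : ℝ) : ℝ := ∫ t in (0 : ℝ)..x, f t

/-- The coefficients of `g_δ = ⟨·, 𝐆_δ ·⟩`, `𝐆_δ = 𝐈 + 2 F_δ 𝐋 - 2 C ℱ_δ 𝐏ᵀ`, for `f = f_δ`. -/
noncomputable def modifiedMetric {m : ℕ}
    (g L : EuclideanSpace ℝ (Fin (m + 1)) → Matrix (Fin (m + 1)) (Fin (m + 1)) ℝ)
    (C : ℝ) (f : ℝ → ℝ) (x : EuclideanSpace ℝ (Fin (m + 1))) :
    Matrix (Fin (m + 1)) (Fin (m + 1)) ℝ :=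
  g x * (1 + (2 * primitive f (x 0)) • L x
    - (2 * C * primitive (primitive f) (x 0)) • projT m)

/-- The part of the tensor `B` that involves `∇𝐋`, where `D i j k = ⟨∂ᵢ, (∇_{∂ⱼ} 𝐋) ∂ₖ⟩` and
`ν k = ⟨∂ₖ, N⟩`. -/
noncomputable def codazziTensor {m : ℕ}
    (g L : EuclideanSpace ℝ (Fin (m + 1)) → Matrix (Fin (m + 1)) (Fin (m + 1)) ℝ)
    (x : EuclideanSpace ℝ (Fin (m + 1))) (i j k l : Fin (m + 1)) : ℝ :=
  let D : Fin (m + 1) → Fin (m + 1) → Fin (m + 1) → ℝ :=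
    fun a b c => ∑ p, g x a p * covDerivEnd g L x b p c
  let ν : Fin (m + 1) → ℝ := fun a => g x a 0
  D i j l * ν k - D j i l * ν k
    - D i j k * ν l + D j i k * ν l
    + D k l j * ν i - D l k j * ν i
    - D k l i * ν j + D l k i * ν j

/-- The operator `ℬ` on two-vectors. -/
noncomputable def opB {m : ℕ}
    (g L : EuclideanSpace ℝ (Fin (m + 1)) → Matrix (Fin (m + 1)) (Fin (m + 1)) ℝ)
    (x : EuclideanSpace ℝ (Fin (m + 1))) : TwoVector (m + 1) →ₗ[ℝ] TwoVector (m + 1) :=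
  (-2 : ℝ) • kulkarniNomizu (L x) (nablaN g x) + opOf (g x) (codazziTensor g L x)

/-- The right hand side
`ℛ - f² 𝐋 ∧ 𝐋 + f ℬ - 2 f' 𝐋 ∧ 𝐏ᴺ + 2 f² 𝐋² ∧ 𝐏ᴺ + 2 C f 𝐏ᵀ ∧ 𝐏ᴺ`, for `f = f_δ`. -/
noncomputable def curvatureExpansion {m : ℕ}
    (g L : EuclideanSpace ℝ (Fin (m + 1)) → Matrix (Fin (m + 1)) (Fin (m + 1)) ℝ)
    (C : ℝ) (f : ℝ → ℝ) (x : EuclideanSpace ℝ (Fin (m + 1))) :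
    TwoVector (m + 1) →ₗ[ℝ] TwoVector (m + 1) :=
  opOf (g x) (riemann g x)
    - (f (x 0) ^ 2) • kulkarniNomizu (L x) (L x)
    + f (x 0) • opB g L x
    - (2 * derivWithin f (Ici 0) (x 0)) • kulkarniNomizu (L x) (projN m)
    + (2 * f (x 0) ^ 2) • kulkarniNomizu (L x ^ 2) (projN m)
    + (2 * C * f (x 0)) • kulkarniNomizu (projT m) (projN m)

/-- The relation `S_δ ≈ T_δ` on the coordinate domain `Ω`, for families of operators on two-vectors,
self-adjoint with respect to the metric `g`: they agree on the boundary, and all eigenvalues of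
`S_δ - T_δ` tend to zero as `δ → 0`, uniformly on compact subsets. -/
def OperatorApprox {m : ℕ} (δmax : ℝ)
    (g : EuclideanSpace ℝ (Fin (m + 1)) → Matrix (Fin (m + 1)) (Fin (m + 1)) ℝ)
    (Ω : Set (EuclideanSpace ℝ (Fin (m + 1))))
    (S T : ℝ → EuclideanSpace ℝ (Fin (m + 1)) →
      (TwoVector (m + 1) →ₗ[ℝ] TwoVector (m + 1))) : Prop :=
  (∀ δ ∈ Ioo 0 δmax, ∀ x ∈ Ω, IsSelfAdjointFor (g x) (S δ x) ∧ IsSelfAdjointFor (g x) (T δ x)) ∧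
  (∀ δ ∈ Ioo 0 δmax, ∀ x ∈ Ω, x 0 = 0 → S δ x = T δ x) ∧
  ∀ K ⊆ Ω, IsCompact K → ∀ ε > 0, ∃ δ₀ > 0, δ₀ ≤ δmax ∧ ∀ δ ∈ Ioo 0 δ₀, ∀ x ∈ K, ∀ μ : ℝ,
    Module.End.HasEigenvalue (S δ x - T δ x) μ → |μ| < ε

end Gluing

/-!
In Fermi coordinates `∂₀` is a unit vector orthogonal to `∂₁, …, ∂ₘ` (`metric_normal_of_geodesic`,
Gauss's lemma), and `𝐋` is self-adjoint with `𝐋 ∂₀ = 0`; `IsFermiData`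
collects these facts together with smoothness and nondegeneracy.

The form of the metric `g_δ` is `g + 2 F_δ b - 2 C ℱ_δ p`, where `b = g 𝐋` and `p = g 𝐏ᵀ`. Since
`ℱ_δ' = F_δ` and `F_δ' = f_δ`, its first two derivatives are polynomials in `f_δ`, `f_δ'`, `F_δ`,
`ℱ_δ` whose coefficients are smooth functions of the point (`pd_modifiedMetric`,
`pd_pd_modifiedMetric`). The curvature tensor is a function of this 2-jet (`riemann_eq_curvForm`) in
which the second derivatives occur linearly. Hence `f_δ'` enters only through the term
`-2 f_δ' 𝐋 ∧ 𝐏ᴺ`, which cancels from the difference of the two sides, and the difference is a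
function `remainder` of the point and of `u = f_δ`, `v = F_δ`, `w = ℱ_δ`
(`riemann_modifiedMetric_sub`).

For `v = w = 0` the 1-jet of `g_δ` differs from that of `g` by `2 u b` in the normal direction only,
and the remainder vanishes by an algebraic identity (`curvForm_normalJet`, `remainder_zero`): the
terms quadratic in `u` are `-𝐋 ∧ 𝐋 + 2 𝐋² ∧ 𝐏ᴺ`; the terms linear in `u` are `2 C 𝐏ᵀ ∧ 𝐏ᴺ`, the
products of `b` with the second fundamental form of the slices, which give `-2 𝐋 ∧ ∇N`, and the
antisymmetrised covariant derivative of `b`, which gives the other part of `ℬ`. On the boundary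
`F_δ` and `ℱ_δ` are zero, so the two sides agree there.

Away from the boundary, `|f_δ| ≤ 1` while `|F_δ|, |ℱ_δ| ≤ δ`. The matrix entries of the operator of
the remainder are continuous at `v = w = 0`, and bound its eigenvalues (`abs_eigenvalue_opOf_le`);
by compactness they tend to zero uniformly for the point in a compact set and `u ∈ [-1, 1]`
(`operatorApprox`).
-/

namespace Gluing

/-! ### Algebra of operators on two-vectors -/

/-- The tensor `½ (aᵢₖ bⱼₗ - aⱼₖ bᵢₗ + bᵢₖ aⱼₗ - bⱼₖ aᵢₗ)`: the bilinear form of `𝐀 ∧ 𝐁` when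
`a`, `b` are the bilinear forms of `𝐀`, `𝐁`. -/
noncomputable def knTensor {n : ℕ} (a b : Matrix (Fin n) (Fin n) ℝ) (i j k l : Fin n) : ℝ :=
  (1 / 2) * (a i k * b j l - a j k * b i l + b i k * a j l - b j k * a i l)

theorem opOf_apply {n : ℕ} (g : Matrix (Fin n) (Fin n) ℝ) (T : Fin n → Fin n → Fin n → Fin n → ℝ)
    (β : TwoVector n) : (opOf g T β).1 = (1 / 4 : ℝ) •
      (g⁻¹ * (contractRight T β.1 - (contractRight T β.1).transpose) * g⁻¹.transpose) := rfl

theorem contractRight_add {n : ℕ} (S T : Fin n → Fin n → Fin n → Fin n → ℝ)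
    (β : Matrix (Fin n) (Fin n) ℝ) :
    contractRight (S + T) β = contractRight S β + contractRight T β := by
  ext i j
  simp [contractRight, add_mul, Finset.sum_add_distrib]

theorem contractRight_smul {n : ℕ} (r : ℝ) (T : Fin n → Fin n → Fin n → Fin n → ℝ)
    (β : Matrix (Fin n) (Fin n) ℝ) :
    contractRight (r • T) β = r • contractRight T β := by
  ext i j
  simp [contractRight, mul_assoc, Finset.mul_sum]

theorem opOf_add {n : ℕ} (g : Matrix (Fin n) (Fin n) ℝ)
    (S T : Fin n → Fin n → Fin n → Fin n → ℝ) : opOf g (S + T) = opOf g S + opOf g T := by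
  ext β : 2
  simp only [opOf_apply, LinearMap.add_apply, Submodule.coe_add, contractRight_add,
    Matrix.transpose_add, ← smul_add, ← Matrix.add_mul, ← Matrix.mul_add]
  congr 3
  abel

theorem opOf_smul {n : ℕ} (g : Matrix (Fin n) (Fin n) ℝ) (r : ℝ)
    (T : Fin n → Fin n → Fin n → Fin n → ℝ) : opOf g (r • T) = r • opOf g T := by
  ext β : 2
  simp only [opOf_apply, LinearMap.smul_apply, SetLike.val_smul, contractRight_smul,
    Matrix.transpose_smul, ← smul_sub, Matrix.mul_smul, Matrix.smul_mul]
  rw [smul_comm]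

theorem opOf_sub {n : ℕ} (g : Matrix (Fin n) (Fin n) ℝ)
    (S T : Fin n → Fin n → Fin n → Fin n → ℝ) : opOf g (S - T) = opOf g S - opOf g T := by
  rw [show S - T = S + (-1 : ℝ) • T by module, opOf_add, opOf_smul]
  module

theorem opOf_zero {n : ℕ} (g : Matrix (Fin n) (Fin n) ℝ) : opOf g 0 = 0 := by
  simpa using opOf_smul g 0 0

theorem kulkarniNomizu_eq_opOf {n : ℕ} (g A B : Matrix (Fin n) (Fin n) ℝ) (hg : g.det ≠ 0) :
    kulkarniNomizu A B = opOf g (knTensor (g * A) (g * B)) := by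
  have hu : IsUnit g.det := isUnit_iff_ne_zero.mpr hg
  ext β : 2
  have hβ : β.1.transpose = -β.1 := β.2
  have hP : contractRight (knTensor (g * A) (g * B)) β.1 = (1 / 2 : ℝ) •
      (((g * A) * β.1 * (g * B).transpose - ((g * A) * β.1 * (g * B).transpose).transpose) +
        ((g * B) * β.1 * (g * A).transpose -
          ((g * B) * β.1 * (g * A).transpose).transpose)) := by
    have key : ∀ (a b : Matrix (Fin n) (Fin n) ℝ) (i j : Fin n),
        (a * β.1 * b.transpose) i j = ∑ k, ∑ l, a i k * b j l * β.1 k l := by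
      intro a b i j
      simp only [Matrix.mul_apply, Matrix.transpose_apply, Finset.sum_mul]
      rw [Finset.sum_comm]
      exact Finset.sum_congr rfl fun _ _ => Finset.sum_congr rfl fun _ _ => by ring
    ext i j
    simp only [contractRight, knTensor, Matrix.of_apply, Matrix.smul_apply, Matrix.add_apply,
      Matrix.sub_apply, Matrix.transpose_apply, key, smul_eq_mul, ← Finset.sum_sub_distrib,
      ← Finset.sum_add_distrib, Finset.mul_sum]
    exact Finset.sum_congr rfl fun _ _ => Finset.sum_congr rfl fun _ _ => by ring
  have hsplit : ∀ X Y : Matrix (Fin n) (Fin n) ℝ,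
      ((g * X) * β.1 * (g * Y).transpose).transpose = -((g * Y) * β.1 * (g * X).transpose) := by
    intro X Y
    simp only [Matrix.transpose_mul, Matrix.transpose_transpose, hβ, Matrix.mul_assoc,
      Matrix.neg_mul, Matrix.mul_neg]
  have hcancel : ∀ X Y : Matrix (Fin n) (Fin n) ℝ,
      g⁻¹ * ((g * X) * β.1 * (g * Y).transpose) * g⁻¹.transpose = X * β.1 * Y.transpose := by
    intro X Y
    have h1 : g.transpose * g⁻¹.transpose = 1 := by
      rw [← Matrix.transpose_mul, Matrix.nonsing_inv_mul g hu, Matrix.transpose_one]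
    rw [Matrix.transpose_mul]
    calc g⁻¹ * ((g * X) * β.1 * (Y.transpose * g.transpose)) * g⁻¹.transpose
        = (g⁻¹ * g) * X * β.1 * Y.transpose * (g.transpose * g⁻¹.transpose) := by
          simp only [Matrix.mul_assoc]
      _ = _ := by rw [Matrix.nonsing_inv_mul g hu, h1, Matrix.one_mul, Matrix.mul_one]
  have hP' : contractRight (knTensor (g * A) (g * B)) β.1 =
      (g * A) * β.1 * (g * B).transpose + (g * B) * β.1 * (g * A).transpose := by
    rw [hP, hsplit, hsplit]
    module
  rw [opOf_apply, hP', Matrix.transpose_add, hsplit, hsplit]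
  have h2 : ∀ Q R : Matrix (Fin n) (Fin n) ℝ, Q + R - (-R + -Q) = (2 : ℝ) • (Q + R) := by
    intro Q R
    module
  rw [h2, Matrix.mul_smul, Matrix.smul_mul, Matrix.mul_add, Matrix.add_mul, hcancel, hcancel]
  simp only [kulkarniNomizu, LinearMap.coe_mk, AddHom.coe_mk]
  module

theorem tensorForm_comm {n : ℕ} {T : Fin n → Fin n → Fin n → Fin n → ℝ}
    (hT : ∀ i j k l, T i j k l = T k l i j) (α β : TwoVector n) :
    tensorForm T α β = tensorForm T β α := by
  unfold tensorForm
  congr 1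
  have h1 : ∀ F : Fin n → Fin n → Fin n → Fin n → ℝ,
      ∑ i, ∑ j, ∑ k, ∑ l, F i j k l = ∑ k, ∑ l, ∑ i, ∑ j, F i j k l := by
    intro F
    simp only [← Fintype.sum_prod_type']
    exact Fintype.sum_equiv ⟨fun p => (p.2.2.1, p.2.2.2, p.1, p.2.1),
      fun p => (p.2.2.1, p.2.2.2, p.1, p.2.1), fun _ => rfl, fun _ => rfl⟩ _ _ fun _ => rfl
  rw [h1]
  refine Finset.sum_congr rfl fun k _ => Finset.sum_congr rfl fun l _ =>
    Finset.sum_congr rfl fun i _ => Finset.sum_congr rfl fun j _ => ?_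
  rw [hT i j k l]
  ring

theorem twoVectorInner_comm {n : ℕ} {g : Matrix (Fin n) (Fin n) ℝ} (hs : g.IsSymm)
    (α β : TwoVector n) : twoVectorInner g α β = twoVectorInner g β α := by
  refine tensorForm_comm (fun i j k l => ?_) α β
  rw [hs.apply k i, hs.apply l j, hs.apply i l, hs.apply j k]
  ring

theorem isSelfAdjointFor_opOf {n : ℕ} {g : Matrix (Fin n) (Fin n) ℝ} (hs : g.IsSymm)
    (hg : g.det ≠ 0) {T : Fin n → Fin n → Fin n → Fin n → ℝ}
    (hT : ∀ i j k l, T i j k l = T k l i j) : IsSelfAdjointFor g (opOf g T) := by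
  intro α β
  rw [twoVectorInner_opOf g hg, twoVectorInner_comm hs, twoVectorInner_opOf g hg,
    tensorForm_comm hT]

theorem knTensor_swap {n : ℕ} {a b : Matrix (Fin n) (Fin n) ℝ} (ha : a.IsSymm) (hb : b.IsSymm)
    (i j k l : Fin n) : knTensor a b i j k l = knTensor a b k l i j := by
  unfold knTensor
  rw [ha.apply k i, hb.apply l j, ha.apply i l, hb.apply j k, hb.apply k i, ha.apply l j,
    hb.apply i l, ha.apply j k]
  ring

/-- The entries of the matrix of `opOf g T`, expressed through `h = g⁻¹`. -/
noncomputable def opCoeff {n : ℕ} (h : Matrix (Fin n) (Fin n) ℝ)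
    (T : Fin n → Fin n → Fin n → Fin n → ℝ) (i j k l : Fin n) : ℝ :=
  (1 / 4) * ∑ a, ∑ b, h i a * h j b * (T a b k l - T b a k l)

theorem opOf_apply_eq_sum {n : ℕ} (g : Matrix (Fin n) (Fin n) ℝ)
    (T : Fin n → Fin n → Fin n → Fin n → ℝ) (β : TwoVector n) (i j : Fin n) :
    (opOf g T β).1 i j = ∑ k, ∑ l, opCoeff g⁻¹ T i j k l * β.1 k l := by
  have h1 : ∀ F : Fin n → Fin n → Fin n → Fin n → ℝ,
      ∑ b, ∑ a, ∑ k, ∑ l, F a b k l = ∑ k, ∑ l, ∑ a, ∑ b, F a b k l := by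
    intro F
    simp only [← Fintype.sum_prod_type']
    exact Fintype.sum_equiv ⟨fun p => (p.2.2.1, p.2.2.2, p.2.1, p.1),
      fun p => (p.2.2.2, p.2.2.1, p.1, p.2.1), fun _ => rfl, fun _ => rfl⟩ _ _ fun _ => rfl
  simp only [opOf_apply, Matrix.smul_apply, Matrix.mul_apply, Matrix.sub_apply,
    Matrix.transpose_apply, contractRight, Matrix.of_apply, smul_eq_mul, opCoeff,
    ← Finset.sum_sub_distrib, Finset.mul_sum, Finset.sum_mul]
  rw [h1]
  exact Finset.sum_congr rfl fun _ _ => Finset.sum_congr rfl fun _ _ =>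
    Finset.sum_congr rfl fun _ _ => Finset.sum_congr rfl fun _ _ => by ring

/-- An eigenvalue is bounded by the sum of the absolute values of the matrix entries: compare both
sides of the eigenvalue equation at an entry of the eigenvector of largest absolute value. -/
theorem abs_eigenvalue_opOf_le {n : ℕ} (g : Matrix (Fin n) (Fin n) ℝ)
    (T : Fin n → Fin n → Fin n → Fin n → ℝ) {μ : ℝ}
    (hμ : Module.End.HasEigenvalue (opOf g T) μ) :
    |μ| ≤ ∑ i, ∑ j, ∑ k, ∑ l, |opCoeff g⁻¹ T i j k l| := by
  obtain ⟨β, hβ⟩ := hμ.exists_hasEigenvector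
  have hne : ∃ p : Fin n × Fin n, β.1 p.1 p.2 ≠ 0 := by
    by_contra! h
    exact hβ.2 (Subtype.ext (Matrix.ext fun i j => h (i, j)))
  obtain ⟨p₀, hp₀⟩ := hne
  obtain ⟨p, -, hp⟩ := Finset.exists_max_image (Finset.univ : Finset (Fin n × Fin n))
    (fun p => |β.1 p.1 p.2|) ⟨p₀, Finset.mem_univ _⟩
  have hpos : 0 < |β.1 p.1 p.2| := (abs_pos.mpr hp₀).trans_le (hp p₀ (Finset.mem_univ _))
  have heq : μ * β.1 p.1 p.2 = ∑ k, ∑ l, opCoeff g⁻¹ T p.1 p.2 k l * β.1 k l := by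
    rw [← opOf_apply_eq_sum, hβ.apply_eq_smul]
    rfl
  have h1 : |μ| * |β.1 p.1 p.2| ≤ (∑ k, ∑ l, |opCoeff g⁻¹ T p.1 p.2 k l|) * |β.1 p.1 p.2| := by
    rw [← abs_mul, heq, Finset.sum_mul]
    refine (Finset.abs_sum_le_sum_abs _ _).trans (Finset.sum_le_sum fun k _ => ?_)
    rw [Finset.sum_mul]
    refine (Finset.abs_sum_le_sum_abs _ _).trans (Finset.sum_le_sum fun l _ => ?_)
    rw [abs_mul]
    exact mul_le_mul_of_nonneg_left (hp (k, l) (Finset.mem_univ _)) (abs_nonneg _)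
  refine (le_of_mul_le_mul_right h1 hpos).trans ?_
  refine le_trans ?_ (Finset.single_le_sum (f := fun i => ∑ j, ∑ k, ∑ l, |opCoeff g⁻¹ T i j k l|)
    (fun i _ => by positivity) (Finset.mem_univ p.1))
  exact Finset.single_le_sum (f := fun j => ∑ k, ∑ l, |opCoeff g⁻¹ T p.1 j k l|)
    (fun i _ => by positivity) (Finset.mem_univ p.2)

/-! ### The curvature tensor as an algebraic function of the 2-jet of the metric -/

/-- The Christoffel symbol of the first kind, `Γᵢⱼ,ₐ = ½ (∂ᵢ gⱼₐ + ∂ⱼ gᵢₐ - ∂ₐ gᵢⱼ)`, as a function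
of `d i j l = ∂ᵢ gⱼₗ`. -/
noncomputable def lowerChristoffel {n : ℕ} (d : Fin n → Fin n → Fin n → ℝ) (i j a : Fin n) : ℝ :=
  (1 / 2) * (d i j a + d j i a - d a i j)

/-- The bilinear form `∑ hᵃᵇ Xₐ Y_b`; for `h` the inverse of a metric, the inner product of
covectors. -/
noncomputable def dualInner {n : ℕ} (h : Matrix (Fin n) (Fin n) ℝ) (X Y : Fin n → ℝ) : ℝ :=
  ∑ a, ∑ b, h a b * X a * Y b

/-- The curvature tensor as a function of the inverse `h` of the metric and of its derivatives
`d₁ i j l = ∂ᵢ gⱼₗ` and `d₂ k i j l = ∂ₖ ∂ᵢ gⱼₗ`. -/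
noncomputable def curvForm {n : ℕ} (h : Matrix (Fin n) (Fin n) ℝ) (d₁ : Fin n → Fin n → Fin n → ℝ)
    (d₂ : Fin n → Fin n → Fin n → Fin n → ℝ) (i j k l : Fin n) : ℝ :=
  (1 / 2) * (d₂ j k i l + d₂ i l j k - d₂ i k j l - d₂ j l i k)
    + (dualInner h (lowerChristoffel d₁ j k) (lowerChristoffel d₁ i l)
      - dualInner h (lowerChristoffel d₁ i k) (lowerChristoffel d₁ j l))

section DualInner

variable {n : ℕ} (h : Matrix (Fin n) (Fin n) ℝ)

theorem dualInner_add_left (X X' Y : Fin n → ℝ) :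
    dualInner h (X + X') Y = dualInner h X Y + dualInner h X' Y := by
  simp only [dualInner, Pi.add_apply, mul_add, add_mul, Finset.sum_add_distrib]

theorem dualInner_smul_left (r : ℝ) (X Y : Fin n → ℝ) :
    dualInner h (r • X) Y = r * dualInner h X Y := by
  simp only [dualInner, Pi.smul_apply, smul_eq_mul, Finset.mul_sum]
  exact Finset.sum_congr rfl fun _ _ => Finset.sum_congr rfl fun _ _ => by ring

variable {h}

theorem dualInner_comm (hs : h.IsSymm) (X Y : Fin n → ℝ) :
    dualInner h X Y = dualInner h Y X := by
  unfold dualInner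
  rw [Finset.sum_comm]
  exact Finset.sum_congr rfl fun a _ => Finset.sum_congr rfl fun b _ => by
    rw [hs.apply a b]; ring

end DualInner

/-- This holds also for singular `G`, whose inverse has the junk value `0`. -/
theorem inv_mul_mul_inv {n : ℕ} (G : Matrix (Fin n) (Fin n) ℝ) : G⁻¹ * G * G⁻¹ = G⁻¹ := by
  by_cases hG : IsUnit G.det
  · rw [Matrix.nonsing_inv_mul G hG, Matrix.one_mul]
  · simp [Matrix.nonsing_inv_apply_not_isUnit G hG]

theorem christoffel_eq {m : ℕ}
    (g : EuclideanSpace ℝ (Fin (m + 1)) → Matrix (Fin (m + 1)) (Fin (m + 1)) ℝ)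
    (x : EuclideanSpace ℝ (Fin (m + 1))) (k i j : Fin (m + 1)) :
    christoffel g x k i j =
      ∑ a, (g x)⁻¹ k a * lowerChristoffel (fun i j l => pd i (fun y => g y j l) x) i j a := by
  simp only [christoffel, lowerChristoffel, Finset.mul_sum]
  exact Finset.sum_congr rfl fun _ _ => by ring

theorem sum_mul_christoffel {m : ℕ}
    {g : EuclideanSpace ℝ (Fin (m + 1)) → Matrix (Fin (m + 1)) (Fin (m + 1)) ℝ}
    {x : EuclideanSpace ℝ (Fin (m + 1))} (hg : (g x).det ≠ 0) (c i j : Fin (m + 1)) :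
    ∑ k, g x c k * christoffel g x k i j =
      lowerChristoffel (fun i j l => pd i (fun y => g y j l) x) i j c := by
  set Γ := lowerChristoffel (fun i j l => pd i (fun y => g y j l) x)
  have h1 : ∀ k, christoffel g x k i j = ((g x)⁻¹.mulVec (Γ i j)) k := fun k =>
    christoffel_eq g x k i j
  have h2 : ∑ k, g x c k * christoffel g x k i j =
      ((g x).mulVec ((g x)⁻¹.mulVec (Γ i j))) c := by
    simp only [h1]
    rfl
  rw [h2, Matrix.mulVec_mulVec, Matrix.mul_nonsing_inv _ (isUnit_iff_ne_zero.mpr hg),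
    Matrix.one_mulVec]

theorem sum_mul_christoffel_mul {m : ℕ}
    {g : EuclideanSpace ℝ (Fin (m + 1)) → Matrix (Fin (m + 1)) (Fin (m + 1)) ℝ}
    {x : EuclideanSpace ℝ (Fin (m + 1))} (hs : (g x).IsSymm) (i j k l : Fin (m + 1)) :
    ∑ p, ∑ q, g x p q * (christoffel g x p i j * christoffel g x q k l) =
      dualInner (g x)⁻¹ (lowerChristoffel (fun i j l => pd i (fun y => g y j l) x) i j)
        (lowerChristoffel (fun i j l => pd i (fun y => g y j l) x) k l) := by
  set Γ := lowerChristoffel (fun i j l => pd i (fun y => g y j l) x)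
  have hc : ∀ p i j, christoffel g x p i j = ((g x)⁻¹.mulVec (Γ i j)) p := fun p i j =>
    christoffel_eq g x p i j
  have hs' : ((g x)⁻¹).transpose = (g x)⁻¹ := by rw [Matrix.transpose_nonsing_inv, hs.eq]
  have h1 : ∑ p, ∑ q, g x p q * (christoffel g x p i j * christoffel g x q k l) =
      ((g x)⁻¹.mulVec (Γ i j)) ⬝ᵥ ((g x).mulVec ((g x)⁻¹.mulVec (Γ k l))) := by
    have : ∀ X Y : Fin (m + 1) → ℝ, ∑ p, ∑ q, g x p q * (X p * Y q) = X ⬝ᵥ (g x).mulVec Y := by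
      intro X Y
      simp only [dotProduct, Matrix.mulVec, Finset.mul_sum]
      exact Finset.sum_congr rfl fun _ _ => Finset.sum_congr rfl fun _ _ => by ring
    simp only [hc]
    exact this _ _
  have h2 : dualInner (g x)⁻¹ (Γ i j) (Γ k l) = Γ i j ⬝ᵥ ((g x)⁻¹.mulVec (Γ k l)) := by
    simp only [dualInner, dotProduct, Matrix.mulVec, Finset.mul_sum]
    exact Finset.sum_congr rfl fun _ _ => Finset.sum_congr rfl fun _ _ => by ring
  rw [h1, h2, ← Matrix.vecMul_transpose, hs', ← Matrix.dotProduct_mulVec, Matrix.mulVec_mulVec,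
    Matrix.mulVec_mulVec, inv_mul_mul_inv]

theorem riemann_eq_curvForm {m : ℕ}
    {g : EuclideanSpace ℝ (Fin (m + 1)) → Matrix (Fin (m + 1)) (Fin (m + 1)) ℝ}
    {x : EuclideanSpace ℝ (Fin (m + 1))} (hs : (g x).IsSymm) (i j k l : Fin (m + 1)) :
    riemann g x i j k l = curvForm (g x)⁻¹ (fun i j l => pd i (fun y => g y j l) x)
      (fun k i j l => pd k (pd i (fun y => g y j l)) x) i j k l := by
  unfold riemann curvForm
  congr 1
  simp only [mul_sub, Finset.sum_sub_distrib, sum_mul_christoffel_mul hs]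

theorem lowerChristoffel_comm {n : ℕ} {d : Fin n → Fin n → Fin n → ℝ}
    (hd : ∀ i j l, d i j l = d i l j) (i j a : Fin n) :
    lowerChristoffel d i j a = lowerChristoffel d j i a := by
  unfold lowerChristoffel
  rw [hd a i j]
  ring

theorem curvForm_swap {n : ℕ} {h : Matrix (Fin n) (Fin n) ℝ} {d₁ : Fin n → Fin n → Fin n → ℝ}
    {d₂ : Fin n → Fin n → Fin n → Fin n → ℝ} (hh : h.IsSymm) (h₁ : ∀ i j l, d₁ i j l = d₁ i l j)
    (h₂ : ∀ k i j l, d₂ k i j l = d₂ k i l j) (h₃ : ∀ k i j l, d₂ k i j l = d₂ i k j l)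
    (i j k l : Fin n) : curvForm h d₁ d₂ i j k l = curvForm h d₁ d₂ k l i j := by
  have hΓ : ∀ i j, lowerChristoffel d₁ i j = lowerChristoffel d₁ j i := fun i j =>
    funext fun a => lowerChristoffel_comm h₁ i j a
  unfold curvForm
  rw [dualInner_comm hh (lowerChristoffel d₁ j k), hΓ l i, hΓ k j, hΓ i k, hΓ j l,
    h₃ l i k j, h₂ i l k j, h₃ k j l i, h₂ j k l i, h₃ k i l j, h₂ i k l j, h₃ l j k i, h₂ j l k i]
  ring

/-- The second derivatives enter the curvature tensor linearly. -/
theorem curvForm_add {n : ℕ} (h : Matrix (Fin n) (Fin n) ℝ) (d₁ : Fin n → Fin n → Fin n → ℝ)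
    (d₂ d₂' : Fin n → Fin n → Fin n → Fin n → ℝ) (i j k l : Fin n) :
    curvForm h d₁ (fun k i j l => d₂ k i j l + d₂' k i j l) i j k l = curvForm h d₁ d₂ i j k l +
      (1 / 2) * (d₂' j k i l + d₂' i l j k - d₂' i k j l - d₂' j l i k) := by
  unfold curvForm
  ring

/-- The coordinates of the normal covector `dx⁰`. -/
def conormal (m : ℕ) (i : Fin (m + 1)) : ℝ := if i = 0 then 1 else 0

/-- The algebraic core: the curvature tensor of a metric whose 1-jet in the normal direction is
changed by `2u b` and whose second derivatives are changed accordingly. In the result, `b` is the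
form of `𝐋`, `dualInner h (b i) (b j)` the form of `𝐋²`, `-Γᵢⱼ,₀` the form of `∇N`, and the last
bracket of the terms linear in `u` is the antisymmetrised covariant derivative of `b`. -/
theorem curvForm_normalJet {m : ℕ} {h b p : Matrix (Fin (m + 1)) (Fin (m + 1)) ℝ}
    {d₁ db : Fin (m + 1) → Fin (m + 1) → Fin (m + 1) → ℝ}
    {d₂ : Fin (m + 1) → Fin (m + 1) → Fin (m + 1) → Fin (m + 1) → ℝ}
    (hs : h.IsSymm) (h0 : ∀ i, h i 0 = conormal m i) (hb0 : ∀ i, b i 0 = 0)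
    (h₁ : ∀ i j l, d₁ i j l = d₁ i l j) (hdb : ∀ i j l, db i j l = db i l j)
    (u C : ℝ) (i j k l : Fin (m + 1)) :
    let ν := conormal m
    let Γ := lowerChristoffel d₁
    let D := fun a c e => db c a e - dualInner h (Γ c a) (b e) - dualInner h (Γ c e) (b a)
    curvForm h (fun i j l => d₁ i j l + ν i * (2 * u * b j l))
      (fun k i j l => d₂ k i j l + ν k * (2 * u * db i j l) + ν i * (2 * u * db k j l)
        - ν i * ν k * (2 * C * u * p j l)) i j k l =
    curvForm h d₁ d₂ i j k l - u ^ 2 * knTensor b b i j k l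
      + u * (-2 * knTensor b (Matrix.of fun i j => -Γ i j 0) i j k l +
        (D i j l * ν k - D j i l * ν k - D i j k * ν l + D j i k * ν l
          + D k l j * ν i - D l k j * ν i - D k l i * ν j + D l k i * ν j))
      + 2 * u ^ 2 * knTensor (Matrix.of fun i j => dualInner h (b i) (b j))
          (Matrix.of fun i j => ν i * ν j) i j k l
      + 2 * C * u * knTensor p (Matrix.of fun i j => ν i * ν j) i j k l := by
  intro ν Γ D
  have hΓs : ∀ i j, Γ i j = Γ j i := fun i j =>
    funext fun a => lowerChristoffel_comm h₁ i j a
  have hν0 : ∀ X : Fin (m + 1) → ℝ, dualInner h X ν = X 0 := by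
    intro X
    have : ∀ a, ∑ b, h a b * X a * ν b = X a * ν a := by
      intro a
      simp [ν, conormal, h0, mul_comm]
    simp only [dualInner, this]
    simp [ν, conormal]
  have h0ν : ∀ X : Fin (m + 1) → ℝ, dualInner h ν X = X 0 := fun X => by
    rw [dualInner_comm hs, hν0]
  have hνν : ν 0 = 1 := by simp [ν, conormal]
  have hsmall : ∀ i j, lowerChristoffel (fun i j l => d₁ i j l + ν i * (2 * u * b j l)) i j =
      Γ i j + (u * ν i) • b j + (u * ν j) • b i + (-(u * b i j)) • ν := by
    intro i j
    funext a
    simp only [lowerChristoffel, Γ, Pi.add_apply, Pi.smul_apply, smul_eq_mul]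
    ring
  have hadd : ∀ X Y Z, dualInner h X (Y + Z) = dualInner h X Y + dualInner h X Z := fun X Y Z => by
    rw [dualInner_comm hs, dualInner_add_left, dualInner_comm hs Y, dualInner_comm hs Z]
  have hsm : ∀ (r : ℝ) X Y, dualInner h X (r • Y) = r * dualInner h X Y := fun r X Y => by
    rw [dualInner_comm hs, dualInner_smul_left, dualInner_comm hs Y]
  have hbΓ : ∀ i j k, dualInner h (b i) (Γ j k) = dualInner h (Γ j k) (b i) := fun _ _ _ =>
    dualInner_comm hs _ _
  unfold curvForm
  simp only [hsmall, dualInner_add_left, dualInner_smul_left, hadd, hsm, hν0, h0ν, hb0, hbΓ]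
  simp only [knTensor, Matrix.of_apply, D, Pi.add_apply, Pi.smul_apply, smul_eq_mul, hb0, hνν]
  rw [hΓs k i, hΓs k j, hΓs l i, hΓs l j, hΓs j i, hΓs l k, hdb k l j, hdb l k j, hdb k l i,
    hdb l k i, dualInner_comm hs (b k) (b i), dualInner_comm hs (b k) (b j),
    dualInner_comm hs (b j) (b i), show lowerChristoffel d₁ = Γ from rfl]
  ring

/-! ### Calculus on the half-space -/

section HalfSpace

variable {m : ℕ}

theorem halfSpace_eq_range (m : ℕ) : halfSpace m = range (𝓡∂ (m + 1)) :=
  (range_modelWithCornersEuclideanHalfSpace (m + 1)).symm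

theorem uniqueDiffOn_halfSpace (m : ℕ) : UniqueDiffOn ℝ (halfSpace m) := by
  rw [halfSpace_eq_range]
  exact (𝓡∂ (m + 1)).uniqueDiffOn

theorem halfSpace_subset_closure_interior (m : ℕ) :
    halfSpace m ⊆ closure (interior (halfSpace m)) := by
  rw [halfSpace_eq_range]
  exact (𝓡∂ (m + 1)).range_subset_closure_interior

variable {i : Fin (m + 1)} {u v : EuclideanSpace ℝ (Fin (m + 1)) → ℝ}
  {x : EuclideanSpace ℝ (Fin (m + 1))}

theorem pd_add (hx : x ∈ halfSpace m) (hu : DifferentiableWithinAt ℝ u (halfSpace m) x)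
    (hv : DifferentiableWithinAt ℝ v (halfSpace m) x) :
    pd i (fun y => u y + v y) x = pd i u x + pd i v x := by
  unfold pd
  rw [fderivWithin_fun_add (uniqueDiffOn_halfSpace m x hx) hu hv]
  rfl

theorem pd_mul (hx : x ∈ halfSpace m) (hu : DifferentiableWithinAt ℝ u (halfSpace m) x)
    (hv : DifferentiableWithinAt ℝ v (halfSpace m) x) :
    pd i (fun y => u y * v y) x = pd i u x * v x + u x * pd i v x := by
  unfold pd
  rw [fderivWithin_fun_mul (uniqueDiffOn_halfSpace m x hx) hu hv]
  simp
  ring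

theorem pd_sum {ι : Type*} {s : Finset ι} {u : ι → EuclideanSpace ℝ (Fin (m + 1)) → ℝ}
    (hx : x ∈ halfSpace m) (hu : ∀ a ∈ s, DifferentiableWithinAt ℝ (u a) (halfSpace m) x) :
    pd i (fun y => ∑ a ∈ s, u a y) x = ∑ a ∈ s, pd i (u a) x := by
  unfold pd
  rw [fderivWithin_fun_sum (uniqueDiffOn_halfSpace m x hx) hu]
  simp

theorem pd_const (c : ℝ) : pd i (fun _ => c) x = 0 := by
  simp [pd]

theorem pd_congr {Ω : Set (EuclideanSpace ℝ (Fin (m + 1)))} (hΩ : Ω ∈ nhdsWithin x (halfSpace m))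
    (hx : x ∈ Ω) (h : EqOn u v Ω) : pd i u x = pd i v x := by
  unfold pd
  rw [Filter.EventuallyEq.fderivWithin_eq (Filter.eventuallyEq_of_mem hΩ h) (h hx)]

/-- Functions of the normal coordinate have only a normal derivative. -/
theorem hasFDerivWithinAt_normal {φ : ℝ → ℝ} {φ' : ℝ} (hφ : HasDerivWithinAt φ φ' (Ici 0) (x 0)) :
    HasFDerivWithinAt (fun y : EuclideanSpace ℝ (Fin (m + 1)) => φ (y 0))
      (φ' • (EuclideanSpace.proj 0 : EuclideanSpace ℝ (Fin (m + 1)) →L[ℝ] ℝ)) (halfSpace m) x :=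
  hφ.comp_hasFDerivWithinAt (f := fun y : EuclideanSpace ℝ (Fin (m + 1)) => y 0) x
    (EuclideanSpace.proj (𝕜 := ℝ) (0 : Fin (m + 1))).hasFDerivWithinAt fun _ hy => hy

theorem pd_normal {φ : ℝ → ℝ} {φ' : ℝ} (hx : x ∈ halfSpace m)
    (hφ : HasDerivWithinAt φ φ' (Ici 0) (x 0)) :
    pd i (fun y => φ (y 0)) x = conormal m i * φ' := by
  unfold pd
  rw [(hasFDerivWithinAt_normal hφ).fderivWithin (uniqueDiffOn_halfSpace m x hx)]
  simp [conormal, mul_comm, eq_comm]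

theorem pd_normal_mul {φ : ℝ → ℝ} {φ' : ℝ} (hx : x ∈ halfSpace m)
    (hφ : HasDerivWithinAt φ φ' (Ici 0) (x 0)) (hu : DifferentiableWithinAt ℝ u (halfSpace m) x) :
    pd i (fun y => φ (y 0) * u y) x = φ (x 0) * pd i u x + conormal m i * (φ' * u x) := by
  rw [pd_mul hx (hasFDerivWithinAt_normal hφ).differentiableWithinAt hu, pd_normal hx hφ]
  ring

/-- A relatively open subset of the half-space. -/
structure IsHalfSpaceDomain (Ω : Set (EuclideanSpace ℝ (Fin (m + 1)))) : Prop where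
  subset : Ω ⊆ halfSpace m
  mem_nhdsWithin : ∀ x ∈ Ω, Ω ∈ nhdsWithin x (halfSpace m)

theorem IsHalfSpaceDomain.contDiffWithinAt {Ω : Set (EuclideanSpace ℝ (Fin (m + 1)))}
    (hΩ : IsHalfSpaceDomain Ω) (hu : ContDiffOn ℝ ∞ u Ω) (hx : x ∈ Ω) :
    ContDiffWithinAt ℝ ∞ u (halfSpace m) x :=
  (hu x hx).mono_of_mem_nhdsWithin (hΩ.mem_nhdsWithin x hx)

theorem IsHalfSpaceDomain.differentiableWithinAt {Ω : Set (EuclideanSpace ℝ (Fin (m + 1)))}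
    (hΩ : IsHalfSpaceDomain Ω) (hu : ContDiffOn ℝ ∞ u Ω) (hx : x ∈ Ω) :
    DifferentiableWithinAt ℝ u (halfSpace m) x :=
  (hΩ.contDiffWithinAt hu hx).differentiableWithinAt (by simp)

theorem IsHalfSpaceDomain.contDiffOn_pd {Ω : Set (EuclideanSpace ℝ (Fin (m + 1)))}
    (hΩ : IsHalfSpaceDomain Ω) (hu : ContDiffOn ℝ ∞ u Ω) (i : Fin (m + 1)) :
    ContDiffOn ℝ ∞ (pd i u) Ω := by
  intro x hx
  have h : ContDiffWithinAt ℝ ∞ (fderivWithin ℝ u (halfSpace m)) (halfSpace m) x :=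
    (hΩ.contDiffWithinAt hu hx).fderivWithin_right (uniqueDiffOn_halfSpace m) (by simp)
      (hΩ.subset hx)
  exact (h.clm_apply contDiffWithinAt_const).mono hΩ.subset

theorem IsHalfSpaceDomain.pd_pd_comm {Ω : Set (EuclideanSpace ℝ (Fin (m + 1)))}
    (hΩ : IsHalfSpaceDomain Ω) (hu : ContDiffOn ℝ ∞ u Ω) (hx : x ∈ Ω) (i k : Fin (m + 1)) :
    pd k (pd i u) x = pd i (pd k u) x := by
  have hd : DifferentiableWithinAt ℝ (fderivWithin ℝ u (halfSpace m)) (halfSpace m) x :=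
    ((hΩ.contDiffWithinAt hu hx).fderivWithin_right (m := ∞) (uniqueDiffOn_halfSpace m) (by simp)
      (hΩ.subset hx)).differentiableWithinAt (by simp)
  have key : ∀ i k : Fin (m + 1), pd k (pd i u) x =
      fderivWithin ℝ (fderivWithin ℝ u (halfSpace m)) (halfSpace m) x
        (EuclideanSpace.single k 1) (EuclideanSpace.single i 1) := by
    intro i k
    show fderivWithin ℝ (fun y => fderivWithin ℝ u (halfSpace m) y (EuclideanSpace.single i 1))
      (halfSpace m) x (EuclideanSpace.single k 1) = _
    rw [fderivWithin_clm_apply (uniqueDiffOn_halfSpace m x (hΩ.subset hx)) hd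
      (differentiableWithinAt_const _)]
    simp
  rw [key, key]
  exact ((hΩ.contDiffWithinAt hu hx).isSymmSndFDerivWithinAt
    (by simpa using WithTop.coe_le_coe.mpr (le_top : (2 : ℕ∞) ≤ ⊤))
    (uniqueDiffOn_halfSpace m) (halfSpace_subset_closure_interior m (hΩ.subset hx))
    (hΩ.subset hx)) _ _

end HalfSpace

/-! ### Primitives of the auxiliary functions -/

theorem hasDerivWithinAt_primitive {f : ℝ → ℝ} (hf : ContinuousOn f (Ici 0)) {t : ℝ}
    (ht : t ∈ Ici (0 : ℝ)) : HasDerivWithinAt (primitive f) (f t) (Ici 0) t := by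
  -- `f` is extended to a continuous function on the line, constant to the left of `0`
  have hc : Continuous fun s => f (max s 0) :=
    hf.comp_continuous (continuous_id.max continuous_const) fun s => le_max_right s 0
  have h1 : HasDerivAt (primitive fun s => f (max s 0)) (f (max t 0)) t :=
    (hc.integral_hasStrictDerivAt 0 t).hasDerivAt
  have heq : EqOn (primitive f) (primitive fun s => f (max s 0)) (Ici 0) := by
    intro s hs
    refine intervalIntegral.integral_congr fun r hr => ?_
    rw [uIcc_of_le hs] at hr
    simp [hr.1]
  have h2 := h1.hasDerivWithinAt.congr heq (heq ht)
  rwa [max_eq_left ht] at h2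

theorem primitive_zero (f : ℝ → ℝ) : primitive f 0 = 0 := by
  simp [primitive]

theorem continuousOn_primitive {f : ℝ → ℝ} (hf : ContinuousOn f (Ici 0)) :
    ContinuousOn (primitive f) (Ici 0) :=
  fun _ ht => (hasDerivWithinAt_primitive hf ht).continuousWithinAt

namespace IsAuxFamily

variable {δmax : ℝ} {f : ℝ → ℝ → ℝ} {δ : ℝ}

theorem continuousOn (hf : IsAuxFamily δmax f) (hδ : δ ∈ Ioo 0 δmax) :
    ContinuousOn (f δ) (Ici 0) := (hf.smooth δ hδ).continuousOn

theorem hasDerivWithinAt (hf : IsAuxFamily δmax f) (hδ : δ ∈ Ioo 0 δmax) {t : ℝ}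
    (ht : t ∈ Ici (0 : ℝ)) :
    HasDerivWithinAt (f δ) (derivWithin (f δ) (Ici 0) t) (Ici 0) t :=
  ((hf.smooth δ hδ).differentiableOn (by simp) t ht).hasDerivWithinAt

theorem abs_le_one (hf : IsAuxFamily δmax f) (hδ : δ ∈ Ioo 0 δmax) (hδ1 : δ ≤ 1) {t : ℝ}
    (ht : 0 ≤ t) : |f δ t| ≤ 1 := by
  have h4 : 0 < δ ^ 4 := pow_pos hδ.1 4
  rcases le_total t (δ ^ 4) with h | h
  · rw [hf.linear δ hδ t ⟨ht, h⟩]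
    have h1 : 0 ≤ t / δ ^ 4 := by positivity
    have h2 : t / δ ^ 4 ≤ 1 := (div_le_one h4).mpr h
    rw [abs_le]
    constructor <;> linarith
  · rcases le_total t δ with h' | h'
    · obtain ⟨h1, h2⟩ := hf.small δ hδ t ⟨h, h'⟩
      have h3 : δ ^ 2 ≤ 1 := pow_le_one₀ hδ.1.le hδ1
      rw [abs_le]
      constructor <;> linarith
    · simp [hf.vanish δ hδ t h']

theorem intervalIntegrable (hf : IsAuxFamily δmax f) (hδ : δ ∈ Ioo 0 δmax) {a b : ℝ}
    (ha : 0 ≤ a) (hb : 0 ≤ b) : IntervalIntegrable (f δ) MeasureTheory.volume a b :=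
  ((hf.continuousOn hδ).mono fun _ hs => (le_min ha hb).trans hs.1).intervalIntegrable

/-- `F_δ` vanishes on `[δ, ∞)`, by the mean value condition. -/
theorem primitive_eq_zero (hf : IsAuxFamily δmax f) (hδ : δ ∈ Ioo 0 δmax) {t : ℝ} (ht : δ ≤ t) :
    primitive (f δ) t = 0 := by
  have h0 : 0 ≤ t := hδ.1.le.trans ht
  have h1 : ∫ s in δ..t, f δ s = 0 := by
    rw [intervalIntegral.integral_congr (g := fun _ => 0)]
    · simp
    · intro s hs
      rw [uIcc_of_le ht] at hs
      exact hf.vanish δ hδ s hs.1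
  rw [primitive, ← intervalIntegral.integral_add_adjacent_intervals
    (hf.intervalIntegrable hδ le_rfl hδ.1.le) (hf.intervalIntegrable hδ hδ.1.le h0), h1,
    hf.mean δ hδ, add_zero]

theorem abs_primitive_le (hf : IsAuxFamily δmax f) (hδ : δ ∈ Ioo 0 δmax) (hδ1 : δ ≤ 1) {t : ℝ}
    (ht : 0 ≤ t) : |primitive (f δ) t| ≤ δ := by
  rcases le_total t δ with h | h
  · have h1 : ‖∫ s in (0 : ℝ)..t, f δ s‖ ≤ 1 * |t - 0| := by
      refine intervalIntegral.norm_integral_le_of_norm_le_const fun s hs => ?_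
      rw [uIoc_of_le ht] at hs
      exact hf.abs_le_one hδ hδ1 hs.1.le
    rw [sub_zero, one_mul, abs_of_nonneg ht, Real.norm_eq_abs] at h1
    exact h1.trans h
  · rw [hf.primitive_eq_zero hδ h, abs_zero]
    exact hδ.1.le

theorem abs_primitive_primitive_le (hf : IsAuxFamily δmax f) (hδ : δ ∈ Ioo 0 δmax) (hδ1 : δ ≤ 1)
    {t : ℝ} (ht : 0 ≤ t) : |primitive (primitive (f δ)) t| ≤ δ := by
  have key : ∀ s, 0 ≤ s → s ≤ δ → |primitive (primitive (f δ)) s| ≤ δ := by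
    intro s hs hsδ
    have h1 : ‖∫ r in (0 : ℝ)..s, primitive (f δ) r‖ ≤ 1 * |s - 0| := by
      refine intervalIntegral.norm_integral_le_of_norm_le_const fun r hr => ?_
      rw [uIoc_of_le hs] at hr
      exact (hf.abs_primitive_le hδ hδ1 hr.1.le).trans hδ1
    rw [sub_zero, one_mul, abs_of_nonneg hs, Real.norm_eq_abs] at h1
    exact h1.trans hsδ
  rcases le_total t δ with h | h
  · exact key t ht h
  · have hi : ∀ a b : ℝ, 0 ≤ a → 0 ≤ b →
        IntervalIntegrable (primitive (f δ)) MeasureTheory.volume a b := fun a b ha hb =>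
      ((continuousOn_primitive (hf.continuousOn hδ)).mono
        fun _ hs => (le_min ha hb).trans hs.1).intervalIntegrable
    have h1 : ∫ s in δ..t, primitive (f δ) s = 0 := by
      rw [intervalIntegral.integral_congr (g := fun _ => 0)]
      · simp
      · intro s hs
        rw [uIcc_of_le h] at hs
        exact hf.primitive_eq_zero hδ hs.1
    have h2 : primitive (primitive (f δ)) t = primitive (primitive (f δ)) δ := by
      rw [primitive, ← intervalIntegral.integral_add_adjacent_intervals
        (hi 0 δ le_rfl hδ.1.le) (hi δ t hδ.1.le ht), h1, add_zero]
      rfl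
    rw [h2]
    exact key δ hδ.1.le le_rfl

end IsAuxFamily

/-! ### The modified metric and its 2-jet -/

/-- A metric `g` and an endomorphism field `L` in coordinates with the properties that Fermi
coordinates give them: `∂₀` is a unit vector orthogonal to `∂₁, …, ∂ₘ`, and `L` is self-adjoint
with `L ∂₀ = 0`. -/
structure IsFermiData {m : ℕ} (Ω : Set (EuclideanSpace ℝ (Fin (m + 1))))
    (g L : EuclideanSpace ℝ (Fin (m + 1)) → Matrix (Fin (m + 1)) (Fin (m + 1)) ℝ) : Prop where
  domain : IsHalfSpaceDomain Ω
  metric_smooth : ∀ i j, ContDiffOn ℝ ∞ (fun x => g x i j) Ω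
  op_smooth : ∀ i j, ContDiffOn ℝ ∞ (fun x => L x i j) Ω
  metric_symm : ∀ x ∈ Ω, (g x).IsSymm
  metric_det : ∀ x ∈ Ω, (g x).det ≠ 0
  metric_normal : ∀ x ∈ Ω, ∀ i, g x i 0 = conormal m i
  op_symm : ∀ x ∈ Ω, (g x * L x).IsSymm
  op_normal : ∀ x ∈ Ω, ∀ k, L x k 0 = 0

section Jets

variable {m : ℕ} (g L : EuclideanSpace ℝ (Fin (m + 1)) → Matrix (Fin (m + 1)) (Fin (m + 1)) ℝ)
  (C u v w : ℝ) (x : EuclideanSpace ℝ (Fin (m + 1)))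

/-- The metric `g (1 + 2 v 𝐋 - 2 C w 𝐏ᵀ)`; here and below `u`, `v`, `w` stand for the values of
`f_δ`, `F_δ`, `ℱ_δ`. -/
noncomputable def jet₀ : Matrix (Fin (m + 1)) (Fin (m + 1)) ℝ :=
  g x + (2 * v) • (g x * L x) - (2 * C * w) • (g x * projT m)

/-- The first derivatives `∂ᵢ (g_δ)ⱼₗ` of the modified metric. -/
noncomputable def jet₁ (i j l : Fin (m + 1)) : ℝ :=
  pd i (fun y => g y j l) x + 2 * v * pd i (fun y => (g y * L y) j l) x
    - 2 * C * w * pd i (fun y => (g y * projT m) j l) x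
    + conormal m i * (2 * u * (g x * L x) j l) - conormal m i * (2 * C * v * (g x * projT m) j l)

/-- The second derivatives `∂ₖ ∂ᵢ (g_δ)ⱼₗ` of the modified metric, without the term that contains
the derivative of `f_δ`. -/
noncomputable def jet₂ (k i j l : Fin (m + 1)) : ℝ :=
  pd k (pd i (fun y => g y j l)) x + 2 * v * pd k (pd i (fun y => (g y * L y) j l)) x
    - 2 * C * w * pd k (pd i (fun y => (g y * projT m) j l)) x
    + conormal m k * (2 * u * pd i (fun y => (g y * L y) j l) x)
    + conormal m i * (2 * u * pd k (fun y => (g y * L y) j l) x)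
    - conormal m k * (2 * C * v * pd i (fun y => (g y * projT m) j l) x)
    - conormal m i * (2 * C * v * pd k (fun y => (g y * projT m) j l) x)
    - conormal m i * conormal m k * (2 * C * u * (g x * projT m) j l)

theorem modifiedMetric_eq_jet₀ (f : ℝ → ℝ) :
    modifiedMetric g L C f x =
      jet₀ g L C (primitive f (x 0)) (primitive (primitive f) (x 0)) x := by
  simp [modifiedMetric, jet₀, Matrix.mul_sub, Matrix.mul_add]

variable {g L} {Ω : Set (EuclideanSpace ℝ (Fin (m + 1)))} {x}

theorem IsFermiData.contDiffOn_form (h : IsFermiData Ω g L) (i j : Fin (m + 1)) :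
    ContDiffOn ℝ ∞ (fun y => (g y * L y) i j) Ω := by
  simp only [Matrix.mul_apply]
  exact ContDiffOn.sum fun k _ => (h.metric_smooth i k).mul (h.op_smooth k j)

theorem IsFermiData.contDiffOn_formT (h : IsFermiData Ω g L) (i j : Fin (m + 1)) :
    ContDiffOn ℝ ∞ (fun y => (g y * projT m) i j) Ω := by
  simp only [Matrix.mul_apply]
  exact ContDiffOn.sum fun k _ => (h.metric_smooth i k).mul contDiffOn_const

theorem IsFermiData.pd_modifiedMetric (h : IsFermiData Ω g L) {f : ℝ → ℝ}
    (hf : ContinuousOn f (Ici 0)) (hx : x ∈ Ω) (i j l : Fin (m + 1)) :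
    pd i (fun y => modifiedMetric g L C f y j l) x =
      jet₁ g L C (f (x 0)) (primitive f (x 0)) (primitive (primitive f) (x 0)) x i j l := by
  have hxH := h.domain.subset hx
  have hx0 : x 0 ∈ Ici (0 : ℝ) := hxH
  have hF := (hasDerivWithinAt_primitive hf hx0).const_mul 2
  have hFF := (hasDerivWithinAt_primitive (continuousOn_primitive hf) hx0).const_mul (-(2 * C))
  have hg := h.domain.differentiableWithinAt (h.metric_smooth j l) hx
  have hb := h.domain.differentiableWithinAt (h.contDiffOn_form j l) hx
  have hp := h.domain.differentiableWithinAt (h.contDiffOn_formT j l) hx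
  have dF := (hasFDerivWithinAt_normal hF).differentiableWithinAt
  have dFF := (hasFDerivWithinAt_normal hFF).differentiableWithinAt
  have heq : (fun y => modifiedMetric g L C f y j l) = fun y => (g y j l +
      2 * primitive f (y 0) * (g y * L y) j l) +
      -(2 * C) * primitive (primitive f) (y 0) * (g y * projT m) j l := by
    funext y
    simp only [modifiedMetric_eq_jet₀, jet₀, Matrix.add_apply, Matrix.sub_apply,
      Matrix.smul_apply, smul_eq_mul]
    ring
  rw [heq, pd_add hxH (hg.fun_add (dF.fun_mul hb)) (dFF.fun_mul hp), pd_add hxH hg (dF.fun_mul hb),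
    pd_normal_mul hxH hF hb, pd_normal_mul hxH hFF hp]
  unfold jet₁
  ring

theorem IsFermiData.pd_pd_modifiedMetric (h : IsFermiData Ω g L) {f : ℝ → ℝ} {f' : ℝ}
    (hf : ContinuousOn f (Ici 0)) (hx : x ∈ Ω) (hf' : HasDerivWithinAt f f' (Ici 0) (x 0))
    (k i j l : Fin (m + 1)) :
    pd k (pd i (fun y => modifiedMetric g L C f y j l)) x =
      jet₂ g L C (f (x 0)) (primitive f (x 0)) (primitive (primitive f) (x 0)) x k i j l +
        conormal m i * conormal m k * (2 * f' * (g x * L x) j l) := by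
  have hxH := h.domain.subset hx
  have hx0 : x 0 ∈ Ici (0 : ℝ) := hxH
  have hF := (hasDerivWithinAt_primitive hf hx0).const_mul 2
  have hFF := (hasDerivWithinAt_primitive (continuousOn_primitive hf) hx0).const_mul (-(2 * C))
  have hf2 := hf'.const_mul (2 * conormal m i)
  have hF2 := (hasDerivWithinAt_primitive hf hx0).const_mul (-(2 * C * conormal m i))
  have hg := h.domain.differentiableWithinAt
    (h.domain.contDiffOn_pd (h.metric_smooth j l) i) hx
  have hb := h.domain.differentiableWithinAt (h.contDiffOn_form j l) hx
  have hp := h.domain.differentiableWithinAt (h.contDiffOn_formT j l) hx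
  have hb' := h.domain.differentiableWithinAt
    (h.domain.contDiffOn_pd (h.contDiffOn_form j l) i) hx
  have hp' := h.domain.differentiableWithinAt
    (h.domain.contDiffOn_pd (h.contDiffOn_formT j l) i) hx
  have dF := (hasFDerivWithinAt_normal hF).differentiableWithinAt
  have dFF := (hasFDerivWithinAt_normal hFF).differentiableWithinAt
  have df2 := (hasFDerivWithinAt_normal hf2).differentiableWithinAt
  have dF2 := (hasFDerivWithinAt_normal hF2).differentiableWithinAt
  have heq : EqOn (pd i (fun y => modifiedMetric g L C f y j l)) (fun y =>
      (((pd i (fun y => g y j l) y +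
      2 * primitive f (y 0) * pd i (fun y => (g y * L y) j l) y) +
      -(2 * C) * primitive (primitive f) (y 0) * pd i (fun y => (g y * projT m) j l) y) +
      2 * conormal m i * f (y 0) * (g y * L y) j l) +
      -(2 * C * conormal m i) * primitive f (y 0) * (g y * projT m) j l) Ω := by
    intro y hy
    simp only [h.pd_modifiedMetric C hf hy, jet₁]
    ring
  have d1 := hg.fun_add (dF.fun_mul hb')
  have d2 := d1.fun_add (dFF.fun_mul hp')
  have d3 := d2.fun_add (df2.fun_mul hb)
  rw [pd_congr (h.domain.mem_nhdsWithin x hx) hx heq, pd_add hxH d3 (dF2.fun_mul hp),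
    pd_add hxH d2 (df2.fun_mul hb), pd_add hxH d1 (dFF.fun_mul hp'), pd_add hxH hg (dF.fun_mul hb'),
    pd_normal_mul hxH hF hb', pd_normal_mul hxH hFF hp', pd_normal_mul hxH hf2 hb,
    pd_normal_mul hxH hF2 hp]
  unfold jet₂
  ring

end Jets

/-! ### The expansion of the curvature tensor -/

section Symmetry

variable {m : ℕ} {Ω : Set (EuclideanSpace ℝ (Fin (m + 1)))}
  {A : EuclideanSpace ℝ (Fin (m + 1)) → Matrix (Fin (m + 1)) (Fin (m + 1)) ℝ}
  {x : EuclideanSpace ℝ (Fin (m + 1))}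

theorem IsHalfSpaceDomain.pd_symm (hΩ : IsHalfSpaceDomain Ω) (hA : ∀ x ∈ Ω, (A x).IsSymm)
    (hx : x ∈ Ω) (i j l : Fin (m + 1)) :
    pd i (fun y => A y j l) x = pd i (fun y => A y l j) x :=
  pd_congr (hΩ.mem_nhdsWithin x hx) hx fun y hy => (hA y hy).apply l j

theorem IsHalfSpaceDomain.pd_pd_symm (hΩ : IsHalfSpaceDomain Ω) (hA : ∀ x ∈ Ω, (A x).IsSymm)
    (hx : x ∈ Ω) (k i j l : Fin (m + 1)) :
    pd k (pd i (fun y => A y j l)) x = pd k (pd i (fun y => A y l j)) x :=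
  pd_congr (hΩ.mem_nhdsWithin x hx) hx fun _ hy => hΩ.pd_symm hA hy i j l

end Symmetry

section Expansion

variable {m : ℕ}

/-- The tensor of `curvatureExpansion`, with `u` and `u'` in place of the values of `f_δ`
and `f_δ'`. -/
noncomputable def expansionTensor
    (g L : EuclideanSpace ℝ (Fin (m + 1)) → Matrix (Fin (m + 1)) (Fin (m + 1)) ℝ)
    (C u u' : ℝ) (x : EuclideanSpace ℝ (Fin (m + 1))) (i j k l : Fin (m + 1)) : ℝ :=
  riemann g x i j k l - u ^ 2 * knTensor (g x * L x) (g x * L x) i j k l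
    + u * (-2 * knTensor (g x * L x) (g x * nablaN g x) i j k l + codazziTensor g L x i j k l)
    - 2 * u' * knTensor (g x * L x) (g x * projN m) i j k l
    + 2 * u ^ 2 * knTensor (g x * L x ^ 2) (g x * projN m) i j k l
    + 2 * C * u * knTensor (g x * projT m) (g x * projN m) i j k l

theorem curvatureExpansion_eq_opOf
    (g L : EuclideanSpace ℝ (Fin (m + 1)) → Matrix (Fin (m + 1)) (Fin (m + 1)) ℝ)
    (C : ℝ) (f : ℝ → ℝ) {x : EuclideanSpace ℝ (Fin (m + 1))} (hg : (g x).det ≠ 0) :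
    curvatureExpansion g L C f x =
      opOf (g x) (expansionTensor g L C (f (x 0)) (derivWithin f (Ici 0) (x 0)) x) := by
  have h : expansionTensor g L C (f (x 0)) (derivWithin f (Ici 0) (x 0)) x =
      riemann g x - (f (x 0) ^ 2) • knTensor (g x * L x) (g x * L x)
      + (f (x 0)) • ((-2 : ℝ) • knTensor (g x * L x) (g x * nablaN g x) + codazziTensor g L x)
      - (2 * derivWithin f (Ici 0) (x 0)) • knTensor (g x * L x) (g x * projN m)
      + (2 * f (x 0) ^ 2) • knTensor (g x * L x ^ 2) (g x * projN m)
      + (2 * C * f (x 0)) • knTensor (g x * projT m) (g x * projN m) := by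
    funext i j k l
    simp only [expansionTensor, Pi.add_apply, Pi.sub_apply, Pi.smul_apply, smul_eq_mul]
  rw [h]
  simp only [opOf_add, opOf_sub, opOf_smul, ← kulkarniNomizu_eq_opOf _ _ _ hg]
  rfl

/-- The difference of the curvature tensor of the modified metric and its expansion, as a function
of the point and of the values `u`, `v`, `w` of `f_δ`, `F_δ`, `ℱ_δ`. The derivative of `f_δ` does
not occur: it enters both sides linearly with the same coefficient. -/
noncomputable def remainder
    (g L : EuclideanSpace ℝ (Fin (m + 1)) → Matrix (Fin (m + 1)) (Fin (m + 1)) ℝ)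
    (C u v w : ℝ) (x : EuclideanSpace ℝ (Fin (m + 1))) (i j k l : Fin (m + 1)) : ℝ :=
  curvForm (jet₀ g L C v w x)⁻¹ (jet₁ g L C u v w x) (jet₂ g L C u v w x) i j k l
    - expansionTensor g L C u 0 x i j k l

namespace IsFermiData

variable {g L : EuclideanSpace ℝ (Fin (m + 1)) → Matrix (Fin (m + 1)) (Fin (m + 1)) ℝ}
  {Ω : Set (EuclideanSpace ℝ (Fin (m + 1)))} {x : EuclideanSpace ℝ (Fin (m + 1))}

theorem mul_projN (h : IsFermiData Ω g L) (hx : x ∈ Ω) :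
    g x * projN m = Matrix.of fun i j => conormal m i * conormal m j := by
  ext i j
  rw [projN, Matrix.mul_diagonal, Matrix.of_apply, ← h.metric_normal x hx i]
  by_cases hj : j = 0
  · simp [hj, conormal]
  · simp [hj, conormal]

theorem mul_projT (h : IsFermiData Ω g L) (hx : x ∈ Ω) :
    g x * projT m = g x - Matrix.of fun i j => conormal m i * conormal m j := by
  ext i j
  rw [projT, Matrix.mul_diagonal, Matrix.sub_apply, Matrix.of_apply, ← h.metric_normal x hx i]
  by_cases hj : j = 0
  · simp [hj, conormal]
  · simp [hj, conormal]

theorem isSymm_projN (h : IsFermiData Ω g L) (hx : x ∈ Ω) : (g x * projN m).IsSymm := by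
  rw [h.mul_projN hx]
  ext i j
  simp [mul_comm]

theorem isSymm_projT (h : IsFermiData Ω g L) (hx : x ∈ Ω) : (g x * projT m).IsSymm := by
  rw [h.mul_projT hx, ← h.mul_projN hx]
  exact (h.metric_symm x hx).sub (h.isSymm_projN hx)

theorem inv_symm (h : IsFermiData Ω g L) (hx : x ∈ Ω) : ((g x)⁻¹).IsSymm := by
  rw [Matrix.IsSymm, Matrix.transpose_nonsing_inv, (h.metric_symm x hx).eq]

theorem inv_mul (h : IsFermiData Ω g L) (hx : x ∈ Ω) : (g x)⁻¹ * g x = 1 :=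
  Matrix.nonsing_inv_mul _ (isUnit_iff_ne_zero.mpr (h.metric_det x hx))

theorem inv_normal (h : IsFermiData Ω g L) (hx : x ∈ Ω) (i : Fin (m + 1)) :
    (g x)⁻¹ i 0 = conormal m i := by
  have h1 : ((g x)⁻¹ * g x) i 0 = (g x)⁻¹ i 0 := by
    simp [Matrix.mul_apply, h.metric_normal x hx, conormal]
  rw [← h1, h.inv_mul hx, Matrix.one_apply, conormal]

theorem isSymm_sq (h : IsFermiData Ω g L) (hx : x ∈ Ω) : (g x * L x ^ 2).IsSymm := by
  have h1 : (L x).transpose * g x = g x * L x := by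
    have := (h.op_symm x hx).eq
    rwa [Matrix.transpose_mul, (h.metric_symm x hx).eq] at this
  rw [Matrix.IsSymm, pow_two, ← Matrix.mul_assoc, Matrix.transpose_mul, (h.op_symm x hx).eq,
    ← Matrix.mul_assoc, h1]

theorem dualInner_form (h : IsFermiData Ω g L) (hx : x ∈ Ω) (X : Fin (m + 1) → ℝ)
    (e : Fin (m + 1)) : dualInner (g x)⁻¹ X ((g x * L x) e) = ∑ a, X a * L x a e := by
  have h1 : ∀ a, L x a e = ∑ b, (g x)⁻¹ a b * (g x * L x) b e := by
    intro a
    rw [← Matrix.mul_apply, ← Matrix.mul_assoc, h.inv_mul hx, Matrix.one_mul]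
  unfold dualInner
  refine Finset.sum_congr rfl fun a _ => ?_
  rw [h1, Finset.mul_sum]
  refine Finset.sum_congr rfl fun b _ => ?_
  rw [(h.op_symm x hx).apply e b]
  ring

theorem mul_sq_eq (h : IsFermiData Ω g L) (hx : x ∈ Ω) : g x * L x ^ 2 =
    Matrix.of fun i j => dualInner (g x)⁻¹ ((g x * L x) i) ((g x * L x) j) := by
  ext i j
  rw [Matrix.of_apply, h.dualInner_form hx, pow_two, ← Matrix.mul_assoc, Matrix.mul_apply]

theorem pd_metric_normal (h : IsFermiData Ω g L) (hx : x ∈ Ω) (i j : Fin (m + 1)) :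
    pd i (fun y => g y j 0) x = 0 := by
  rw [pd_congr (h.domain.mem_nhdsWithin x hx) hx fun y hy => h.metric_normal y hy j, pd_const]

/-- The form of `∇N` is half the normal derivative of the metric. -/
theorem mul_nablaN (h : IsFermiData Ω g L) (hx : x ∈ Ω) : g x * nablaN g x =
    Matrix.of fun i j => -lowerChristoffel (fun i j l => pd i (fun y => g y j l) x) i j 0 := by
  ext i j
  simp only [Matrix.mul_apply, nablaN, Matrix.of_apply]
  rw [sum_mul_christoffel (h.metric_det x hx)]
  simp only [lowerChristoffel, h.pd_metric_normal hx,
    h.domain.pd_symm h.metric_symm hx j 0 i, h.domain.pd_symm h.metric_symm hx 0 j i]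
  ring

theorem isSymm_nablaN (h : IsFermiData Ω g L) (hx : x ∈ Ω) : (g x * nablaN g x).IsSymm := by
  rw [h.mul_nablaN hx]
  ext i j
  simp only [Matrix.transpose_apply, Matrix.of_apply]
  rw [lowerChristoffel_comm fun i j l => h.domain.pd_symm h.metric_symm hx i j l]

/-- Since the metric is parallel, `⟨∂ₐ, (∇_{∂_c} L) ∂ₑ⟩` is the covariant derivative of the
bilinear form of `L`. -/
theorem sum_mul_covDerivEnd (h : IsFermiData Ω g L) (hx : x ∈ Ω) (a c e : Fin (m + 1)) :
    ∑ p, g x a p * covDerivEnd g L x c p e = pd c (fun y => (g y * L y) a e) x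
      - dualInner (g x)⁻¹ (lowerChristoffel (fun i j l => pd i (fun y => g y j l) x) c a)
          ((g x * L x) e)
      - dualInner (g x)⁻¹ (lowerChristoffel (fun i j l => pd i (fun y => g y j l) x) c e)
          ((g x * L x) a) := by
  set Γ := lowerChristoffel (fun i j l => pd i (fun y => g y j l) x) with hΓ
  have hpd : pd c (fun y => (g y * L y) a e) x =
      ∑ p, (pd c (fun y => g y a p) x * L x p e + g x a p * pd c (fun y => L y p e) x) := by
    have hd := fun p => h.domain.differentiableWithinAt (h.metric_smooth a p) hx
    have hd' := fun p => h.domain.differentiableWithinAt (h.op_smooth p e) hx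
    simp only [Matrix.mul_apply]
    rw [pd_sum (h.domain.subset hx) fun p _ => (hd p).fun_mul (hd' p)]
    exact Finset.sum_congr rfl fun p _ => pd_mul (h.domain.subset hx) (hd p) (hd' p)
  have h2 : ∑ p, g x a p * ∑ q, christoffel g x p c q * L x q e = ∑ q, Γ c q a * L x q e := by
    simp only [hΓ, ← sum_mul_christoffel (h.metric_det x hx), Finset.mul_sum, Finset.sum_mul]
    rw [Finset.sum_comm]
    exact Finset.sum_congr rfl fun _ _ => Finset.sum_congr rfl fun _ _ => by ring
  have h3 : ∑ p, g x a p * ∑ q, christoffel g x q c e * L x p q =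
      dualInner (g x)⁻¹ (Γ c e) ((g x * L x) a) := by
    have h4 : ∑ p, g x a p * ∑ q, christoffel g x q c e * L x p q =
        ∑ q, christoffel g x q c e * (g x * L x) a q := by
      simp only [Matrix.mul_apply, Finset.mul_sum]
      rw [Finset.sum_comm]
      exact Finset.sum_congr rfl fun _ _ => Finset.sum_congr rfl fun _ _ => by ring
    rw [h4, dualInner_comm (h.inv_symm hx)]
    unfold dualInner
    refine Finset.sum_congr rfl fun q _ => ?_
    rw [christoffel_eq, Finset.sum_mul]
    exact Finset.sum_congr rfl fun _ _ => by ring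
  have h5 : ∀ q, Γ c q a = pd c (fun y => g y a q) x - Γ c a q := by
    intro q
    simp only [hΓ, lowerChristoffel, h.domain.pd_symm h.metric_symm hx c q a]
    ring
  have h6 : ∑ p, g x a p * covDerivEnd g L x c p e =
      ∑ p, g x a p * pd c (fun y => L y p e) x
        + ∑ p, g x a p * ∑ q, christoffel g x p c q * L x q e
        - ∑ p, g x a p * ∑ q, christoffel g x q c e * L x p q := by
    rw [← Finset.sum_add_distrib, ← Finset.sum_sub_distrib]
    refine Finset.sum_congr rfl fun p _ => ?_
    unfold covDerivEnd
    ring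
  rw [h6, h2, h3, hpd, h.dualInner_form hx (Γ c a) e, Finset.sum_add_distrib]
  simp only [h5, sub_mul, Finset.sum_sub_distrib]
  ring

theorem isSymm_modifiedMetric (h : IsFermiData Ω g L) (C : ℝ) (f : ℝ → ℝ) (hx : x ∈ Ω) :
    (modifiedMetric g L C f x).IsSymm := by
  rw [modifiedMetric_eq_jet₀]
  exact ((h.metric_symm x hx).add ((h.op_symm x hx).smul _)).sub ((h.isSymm_projT hx).smul _)

/-- The curvature tensor of the modified metric differs from its expansion by `remainder`. -/
theorem riemann_modifiedMetric_sub (h : IsFermiData Ω g L) (C : ℝ) {f : ℝ → ℝ} {f' : ℝ}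
    (hf : ContinuousOn f (Ici 0)) (hx : x ∈ Ω) (hf' : HasDerivWithinAt f f' (Ici 0) (x 0)) :
    riemann (modifiedMetric g L C f) x - expansionTensor g L C (f (x 0)) f' x =
      remainder g L C (f (x 0)) (primitive f (x 0)) (primitive (primitive f) (x 0)) x := by
  have hs := h.isSymm_modifiedMetric C f hx
  funext i j k l
  simp only [Pi.sub_apply, riemann_eq_curvForm hs, h.pd_modifiedMetric C hf hx,
    h.pd_pd_modifiedMetric C hf hx hf']
  rw [curvForm_add, modifiedMetric_eq_jet₀]
  unfold remainder expansionTensor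
  rw [h.mul_projN hx]
  simp only [knTensor, Matrix.of_apply]
  ring

/-- Where `F_δ` and `ℱ_δ` vanish, the expansion is exact. -/
theorem remainder_zero (h : IsFermiData Ω g L) (C u : ℝ) (hx : x ∈ Ω) :
    remainder g L C u 0 0 x = 0 := by
  funext i j k l
  have h₁ : ∀ i j l, pd i (fun y => g y j l) x = pd i (fun y => g y l j) x :=
    fun i j l => h.domain.pd_symm h.metric_symm hx i j l
  have hdb : ∀ i j l, pd i (fun y => (g y * L y) j l) x = pd i (fun y => (g y * L y) l j) x :=
    fun i j l => h.domain.pd_symm h.op_symm hx i j l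
  have hb0 : ∀ i, (g x * L x) i 0 = 0 := fun i => by
    simp [Matrix.mul_apply, h.op_normal x hx]
  have hj0 : jet₀ g L C 0 0 x = g x := by simp [jet₀]
  have hj1 : jet₁ g L C u 0 0 x =
      fun i j l => pd i (fun y => g y j l) x + conormal m i * (2 * u * (g x * L x) j l) := by
    funext i j l
    simp [jet₁]
  have hj2 : jet₂ g L C u 0 0 x = fun k i j l => pd k (pd i (fun y => g y j l)) x
      + conormal m k * (2 * u * pd i (fun y => (g y * L y) j l) x)
      + conormal m i * (2 * u * pd k (fun y => (g y * L y) j l) x)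
      - conormal m i * conormal m k * (2 * C * u * (g x * projT m) j l) := by
    funext k i j l
    simp [jet₂]
  have hmain := curvForm_normalJet (p := g x * projT m)
    (d₂ := fun k i j l => pd k (pd i (fun y => g y j l)) x)
    (h.inv_symm hx) (h.inv_normal hx) hb0 h₁ hdb u C i j k l
  unfold remainder expansionTensor codazziTensor
  rw [hj0, hj1, hj2, hmain, riemann_eq_curvForm (h.metric_symm x hx), ← h.mul_sq_eq hx,
    ← h.mul_projN hx, ← h.mul_nablaN hx]
  simp only [h.sum_mul_covDerivEnd hx, h.metric_normal x hx, Pi.zero_apply]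
  ring

end IsFermiData

end Expansion

/-! ### Smoothness and continuity -/

theorem contDiffOn_det {E : Type*} [NormedAddCommGroup E] [NormedSpace ℝ E] {n : ℕ}
    {A : E → Matrix (Fin n) (Fin n) ℝ} {s : Set E}
    (hA : ∀ i j, ContDiffOn ℝ ∞ (fun x => A x i j) s) :
    ContDiffOn ℝ ∞ (fun x => (A x).det) s := by
  simp only [Matrix.det_apply']
  exact ContDiffOn.sum fun σ _ => contDiffOn_const.mul (contDiffOn_prod fun i _ => hA _ _)

theorem contDiffOn_inv {E : Type*} [NormedAddCommGroup E] [NormedSpace ℝ E] {n : ℕ}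
    {A : E → Matrix (Fin n) (Fin n) ℝ} {s : Set E}
    (hA : ∀ i j, ContDiffOn ℝ ∞ (fun x => A x i j) s) (hdet : ∀ x ∈ s, (A x).det ≠ 0)
    (i j : Fin n) : ContDiffOn ℝ ∞ (fun x => (A x)⁻¹ i j) s := by
  simp only [Matrix.inv_def, Ring.inverse_eq_inv', Matrix.smul_apply, smul_eq_mul,
    Matrix.adjugate_apply]
  refine ((contDiffOn_det hA).inv hdet).mul (contDiffOn_det fun a b => ?_)
  by_cases ha : a = j
  · subst ha
    simpa using contDiffOn_const
  · simpa [Matrix.updateRow_ne ha] using hA a b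

theorem continuousWithinAt_matrix_inv {Z : Type*} [TopologicalSpace Z] {n : ℕ}
    {A : Z → Matrix (Fin n) (Fin n) ℝ} {s : Set Z} {z : Z}
    (hA : ∀ i j, ContinuousWithinAt (fun z => A z i j) s z) (hdet : (A z).det ≠ 0) (i j : Fin n) :
    ContinuousWithinAt (fun z => (A z)⁻¹ i j) s z := by
  have hA' : ContinuousWithinAt A s z :=
    continuousWithinAt_pi.mpr fun i => continuousWithinAt_pi.mpr fun j => hA i j
  have h1 : ContinuousWithinAt (fun z => (A z).det) s z :=
    (Continuous.matrix_det continuous_id).continuousAt.comp_continuousWithinAt hA'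
  have h2 : ContinuousWithinAt (fun z => (A z).adjugate i j) s z :=
    ((Continuous.matrix_adjugate continuous_id).matrix_elem i
      j).continuousAt.comp_continuousWithinAt hA'
  simp only [Matrix.inv_def, Ring.inverse_eq_inv', Matrix.smul_apply, smul_eq_mul]
  exact (h1.inv₀ hdet).mul h2

theorem continuousWithinAt_curvForm {Z : Type*} [TopologicalSpace Z] {n : ℕ}
    {h : Z → Matrix (Fin n) (Fin n) ℝ} {d₁ : Z → Fin n → Fin n → Fin n → ℝ}
    {d₂ : Z → Fin n → Fin n → Fin n → Fin n → ℝ} {s : Set Z} {z : Z}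
    (hh : ∀ i j, ContinuousWithinAt (fun z => h z i j) s z)
    (h₁ : ∀ i j l, ContinuousWithinAt (fun z => d₁ z i j l) s z)
    (h₂ : ∀ k i j l, ContinuousWithinAt (fun z => d₂ z k i j l) s z) (i j k l : Fin n) :
    ContinuousWithinAt (fun z => curvForm (h z) (d₁ z) (d₂ z) i j k l) s z := by
  have hΓ : ∀ i j a, ContinuousWithinAt (fun z => lowerChristoffel (d₁ z) i j a) s z := by
    intro i j a
    unfold lowerChristoffel
    fun_prop
  have hD : ∀ i j k l, ContinuousWithinAt (fun z => dualInner (h z) (lowerChristoffel (d₁ z) i j)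
      (lowerChristoffel (d₁ z) k l)) s z := fun i j k l =>
    tendsto_finsetSum _ fun a _ => tendsto_finsetSum _ fun b _ =>
      ((hh a b).mul (hΓ i j a)).mul (hΓ k l b)
  unfold curvForm
  fun_prop

theorem continuousWithinAt_knTensor {Z : Type*} [TopologicalSpace Z] {n : ℕ}
    {a b : Z → Matrix (Fin n) (Fin n) ℝ} {s : Set Z} {z : Z}
    (ha : ∀ i j, ContinuousWithinAt (fun z => a z i j) s z)
    (hb : ∀ i j, ContinuousWithinAt (fun z => b z i j) s z) (i j k l : Fin n) :
    ContinuousWithinAt (fun z => knTensor (a z) (b z) i j k l) s z := by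
  unfold knTensor
  fun_prop

theorem continuousWithinAt_opCoeff {Z : Type*} [TopologicalSpace Z] {n : ℕ}
    {h : Z → Matrix (Fin n) (Fin n) ℝ} {T : Z → Fin n → Fin n → Fin n → Fin n → ℝ}
    {s : Set Z} {z : Z} (hh : ∀ i j, ContinuousWithinAt (fun z => h z i j) s z)
    (hT : ∀ i j k l, ContinuousWithinAt (fun z => T z i j k l) s z) (i j k l : Fin n) :
    ContinuousWithinAt (fun z => opCoeff (h z) (T z) i j k l) s z := by
  have hsum : ContinuousWithinAt
      (fun z => ∑ a, ∑ b, h z i a * h z j b * (T z a b k l - T z b a k l)) s z :=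
    tendsto_finsetSum _ fun a _ => tendsto_finsetSum _ fun b _ =>
      ((hh i a).mul (hh j b)).mul ((hT a b k l).sub (hT b a k l))
  exact continuousWithinAt_const.mul hsum

namespace IsFermiData

variable {m : ℕ} {g L : EuclideanSpace ℝ (Fin (m + 1)) → Matrix (Fin (m + 1)) (Fin (m + 1)) ℝ}
  {Ω : Set (EuclideanSpace ℝ (Fin (m + 1)))} {x : EuclideanSpace ℝ (Fin (m + 1))}

theorem contDiffOn_inv (h : IsFermiData Ω g L) (i j : Fin (m + 1)) :
    ContDiffOn ℝ ∞ (fun x => (g x)⁻¹ i j) Ω :=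
  Gluing.contDiffOn_inv h.metric_smooth h.metric_det i j

theorem contDiffOn_christoffel (h : IsFermiData Ω g L) (k i j : Fin (m + 1)) :
    ContDiffOn ℝ ∞ (fun x => christoffel g x k i j) Ω := by
  have hd := fun i j l => h.domain.contDiffOn_pd (h.metric_smooth j l) i
  unfold christoffel
  exact contDiffOn_const.mul (ContDiffOn.sum fun l _ => (h.contDiffOn_inv k l).mul
    (((hd i j l).add (hd j i l)).sub (hd l i j)))

theorem contDiffOn_covDerivEnd (h : IsFermiData Ω g L) (i k l : Fin (m + 1)) :
    ContDiffOn ℝ ∞ (fun x => covDerivEnd g L x i k l) Ω := by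
  unfold covDerivEnd
  exact ((h.domain.contDiffOn_pd (h.op_smooth k l) i).add (ContDiffOn.sum fun p _ =>
    (h.contDiffOn_christoffel k i p).mul (h.op_smooth p l))).sub (ContDiffOn.sum fun p _ =>
    (h.contDiffOn_christoffel p i l).mul (h.op_smooth k p))

theorem contDiffOn_codazziTensor (h : IsFermiData Ω g L) (i j k l : Fin (m + 1)) :
    ContDiffOn ℝ ∞ (fun x => codazziTensor g L x i j k l) Ω := by
  have hD : ∀ a b c, ContDiffOn ℝ ∞ (fun x => ∑ p, g x a p * covDerivEnd g L x b p c) Ω :=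
    fun a b c => ContDiffOn.sum fun p _ => (h.metric_smooth a p).mul (h.contDiffOn_covDerivEnd b p c)
  have hν := fun a => h.metric_smooth a 0
  unfold codazziTensor
  exact ((((((((hD i j l).mul (hν k)).sub ((hD j i l).mul (hν k))).sub ((hD i j k).mul (hν l))).add
    ((hD j i k).mul (hν l))).add ((hD k l j).mul (hν i))).sub ((hD l k j).mul (hν i))).sub
    ((hD k l i).mul (hν j))).add ((hD l k i).mul (hν j))

theorem contDiffOn_opB (h : IsFermiData Ω g L) (β : TwoVector (m + 1)) (i j : Fin (m + 1)) :
    ContDiffOn ℝ ∞ (fun x => (opB g L x β).1 i j) Ω := by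
  have hN : ∀ i j, ContDiffOn ℝ ∞ (fun x => nablaN g x i j) Ω := fun i j =>
    h.contDiffOn_christoffel i j 0
  have hmul : ∀ A B : EuclideanSpace ℝ (Fin (m + 1)) → Matrix (Fin (m + 1)) (Fin (m + 1)) ℝ,
      (∀ i j, ContDiffOn ℝ ∞ (fun x => A x i j) Ω) → (∀ i j, ContDiffOn ℝ ∞ (fun x => B x i j) Ω) →
      ContDiffOn ℝ ∞ (fun x => (A x * β.1 * (B x).transpose) i j) Ω := by
    intro A B hA hB
    simp only [Matrix.mul_apply, Matrix.transpose_apply]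
    exact ContDiffOn.sum fun k _ =>
      (ContDiffOn.sum fun l _ => (hA i l).mul contDiffOn_const).mul (hB j k)
  have hexp : ∀ x, (opB g L x β).1 i j =
      -2 * ((1 / 2) * ((L x * β.1 * (nablaN g x).transpose) i j +
        (nablaN g x * β.1 * (L x).transpose) i j)) +
      ∑ k, ∑ l, opCoeff (g x)⁻¹ (codazziTensor g L x) i j k l * β.1 k l := by
    intro x
    rw [← opOf_apply_eq_sum]
    rfl
  simp only [hexp]
  refine (contDiffOn_const.mul (contDiffOn_const.mul ((hmul _ _ h.op_smooth hN).add
    (hmul _ _ hN h.op_smooth)))).add (ContDiffOn.sum fun k _ => ContDiffOn.sum fun l _ =>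
    ContDiffOn.mul ?_ contDiffOn_const)
  unfold opCoeff
  exact contDiffOn_const.mul (ContDiffOn.sum fun a _ => ContDiffOn.sum fun b _ =>
    ((h.contDiffOn_inv i a).mul (h.contDiffOn_inv j b)).mul
      ((h.contDiffOn_codazziTensor a b k l).sub (h.contDiffOn_codazziTensor b a k l)))

/-- The matrix entries of the remainder are jointly continuous at the points with `v = w = 0`: there
the modified metric is `g`, so that its inverse depends continuously on all variables. -/
theorem continuousWithinAt_opCoeff_remainder (h : IsFermiData Ω g L) (C : ℝ) (hx : x ∈ Ω) (u : ℝ)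
    (i j k l : Fin (m + 1)) :
    ContinuousWithinAt (fun z : (ℝ × ℝ) × (EuclideanSpace ℝ (Fin (m + 1)) × ℝ) =>
      opCoeff (g z.2.1)⁻¹ (remainder g L C z.2.2 z.1.1 z.1.2 z.2.1) i j k l)
      {z | z.2.1 ∈ Ω} ((0, 0), (x, u)) := by
  set s : Set ((ℝ × ℝ) × (EuclideanSpace ℝ (Fin (m + 1)) × ℝ)) := {z | z.2.1 ∈ Ω}
  set z₀ : (ℝ × ℝ) × (EuclideanSpace ℝ (Fin (m + 1)) × ℝ) := ((0, 0), (x, u))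
  have lift : ∀ φ : EuclideanSpace ℝ (Fin (m + 1)) → ℝ, ContDiffOn ℝ ∞ φ Ω →
      ContinuousWithinAt (fun z : (ℝ × ℝ) × (EuclideanSpace ℝ (Fin (m + 1)) × ℝ) => φ z.2.1)
        s z₀ := fun φ hφ =>
    ContinuousWithinAt.comp (t := Ω) (hφ.continuousOn x hx)
      (continuous_fst.comp continuous_snd).continuousWithinAt fun _ hz => hz
  have hg := fun i j => lift _ (h.metric_smooth i j)
  have hb := fun i j => lift _ (h.contDiffOn_form i j)
  have hp := fun i j => lift _ (h.contDiffOn_formT i j)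
  have hg1 := fun k i j => lift _ (h.domain.contDiffOn_pd (h.metric_smooth i j) k)
  have hb1 := fun k i j => lift _ (h.domain.contDiffOn_pd (h.contDiffOn_form i j) k)
  have hp1 := fun k i j => lift _ (h.domain.contDiffOn_pd (h.contDiffOn_formT i j) k)
  have hg2 := fun l k i j => lift _ (h.domain.contDiffOn_pd
    (h.domain.contDiffOn_pd (h.metric_smooth i j) k) l)
  have hb2 := fun l k i j => lift _ (h.domain.contDiffOn_pd
    (h.domain.contDiffOn_pd (h.contDiffOn_form i j) k) l)
  have hp2 := fun l k i j => lift _ (h.domain.contDiffOn_pd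
    (h.domain.contDiffOn_pd (h.contDiffOn_formT i j) k) l)
  have hu : ContinuousWithinAt (fun z : (ℝ × ℝ) × (EuclideanSpace ℝ (Fin (m + 1)) × ℝ) => z.2.2)
    s z₀ := by fun_prop
  have hv : ContinuousWithinAt (fun z : (ℝ × ℝ) × (EuclideanSpace ℝ (Fin (m + 1)) × ℝ) => z.1.1)
    s z₀ := by fun_prop
  have hw : ContinuousWithinAt (fun z : (ℝ × ℝ) × (EuclideanSpace ℝ (Fin (m + 1)) × ℝ) => z.1.2)
    s z₀ := by fun_prop
  have hc : ∀ {r : ℝ}, ContinuousWithinAt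
    (fun _ : (ℝ × ℝ) × (EuclideanSpace ℝ (Fin (m + 1)) × ℝ) => r) s z₀ := fun {_} =>
    continuousWithinAt_const
  have hinv := fun i j => lift _ (h.contDiffOn_inv i j)
  have hN : ∀ i j, ContinuousWithinAt
      (fun z : (ℝ × ℝ) × (EuclideanSpace ℝ (Fin (m + 1)) × ℝ) => (g z.2.1 * nablaN g z.2.1) i j)
      s z₀ := fun i j => lift (fun x => (g x * nablaN g x) i j) (by
    simp only [Matrix.mul_apply]
    exact ContDiffOn.sum fun k _ => (h.metric_smooth i k).mul (h.contDiffOn_christoffel k j 0))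
  have hPN : ∀ i j, ContinuousWithinAt
      (fun z : (ℝ × ℝ) × (EuclideanSpace ℝ (Fin (m + 1)) × ℝ) => (g z.2.1 * projN m) i j)
      s z₀ := fun i j => lift (fun x => (g x * projN m) i j) (by
    simp only [Matrix.mul_apply]
    exact ContDiffOn.sum fun k _ => (h.metric_smooth i k).mul contDiffOn_const)
  have hL2 : ∀ i j, ContinuousWithinAt
      (fun z : (ℝ × ℝ) × (EuclideanSpace ℝ (Fin (m + 1)) × ℝ) => (g z.2.1 * L z.2.1 ^ 2) i j)
      s z₀ := fun i j => lift (fun x => (g x * L x ^ 2) i j) (by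
    have heq : ∀ x, (g x * L x ^ 2) i j = ∑ k, (g x * L x) i k * L x k j := fun x => by
      rw [pow_two, ← Matrix.mul_assoc, Matrix.mul_apply]
    simp only [heq]
    exact ContDiffOn.sum fun k _ => (h.contDiffOn_form i k).mul (h.op_smooth k j))
  have hcod := fun i j k l => lift _ (h.contDiffOn_codazziTensor i j k l)
  have hjinv : ∀ i j, ContinuousWithinAt
      (fun z : (ℝ × ℝ) × (EuclideanSpace ℝ (Fin (m + 1)) × ℝ) =>
        (jet₀ g L C z.1.1 z.1.2 z.2.1)⁻¹ i j) s z₀ := by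
    refine continuousWithinAt_matrix_inv (fun i j => ?_) ?_
    · simp only [jet₀, Matrix.add_apply, Matrix.sub_apply, Matrix.smul_apply, smul_eq_mul]
      exact ((hg i j).add ((hc.mul hv).mul (hb i j))).sub ((hc.mul hw).mul (hp i j))
    · simpa [jet₀, z₀] using h.metric_det x hx
  have hj1 : ∀ i j l, ContinuousWithinAt
      (fun z : (ℝ × ℝ) × (EuclideanSpace ℝ (Fin (m + 1)) × ℝ) =>
        jet₁ g L C z.2.2 z.1.1 z.1.2 z.2.1 i j l) s z₀ := by
    intro i j l
    exact ((((hg1 i j l).add ((hc.mul hv).mul (hb1 i j l))).sub ((hc.mul hw).mul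
      (hp1 i j l))).add (hc.mul ((hc.mul hu).mul (hb j l)))).sub
      (hc.mul ((hc.mul hv).mul (hp j l)))
  have hj2 : ∀ k i j l, ContinuousWithinAt
      (fun z : (ℝ × ℝ) × (EuclideanSpace ℝ (Fin (m + 1)) × ℝ) =>
        jet₂ g L C z.2.2 z.1.1 z.1.2 z.2.1 k i j l) s z₀ := by
    intro k i j l
    exact (((((((hg2 k i j l).add ((hc.mul hv).mul (hb2 k i j l))).sub ((hc.mul hw).mul
      (hp2 k i j l))).add (hc.mul ((hc.mul hu).mul (hb1 i j l)))).add
      (hc.mul ((hc.mul hu).mul (hb1 k j l)))).sub (hc.mul ((hc.mul hv).mul (hp1 i j l)))).sub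
      (hc.mul ((hc.mul hv).mul (hp1 k j l)))).sub (hc.mul ((hc.mul hu).mul (hp j l)))
  have hriem : ∀ i j k l, ContinuousWithinAt
      (fun z : (ℝ × ℝ) × (EuclideanSpace ℝ (Fin (m + 1)) × ℝ) => riemann g z.2.1 i j k l)
      s z₀ := by
    intro i j k l
    refine (continuousWithinAt_curvForm hinv hg1 hg2 i j k l).congr_of_mem (fun z hz => ?_) hx
    exact riemann_eq_curvForm (h.metric_symm _ hz) i j k l
  refine continuousWithinAt_opCoeff hinv (fun i j k l => ?_) i j k l
  exact (continuousWithinAt_curvForm hjinv hj1 hj2 i j k l).sub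
    ((((((hriem i j k l).sub ((hu.pow 2).mul (continuousWithinAt_knTensor hb hb i j k l))).add
      (hu.mul ((hc.mul (continuousWithinAt_knTensor hb hN i j k l)).add (hcod i j k l)))).sub
      (hc.mul (continuousWithinAt_knTensor hb hPN i j k l))).add
      ((hc.mul (hu.pow 2)).mul (continuousWithinAt_knTensor hL2 hPN i j k l))).add
      ((hc.mul hu).mul (continuousWithinAt_knTensor hp hPN i j k l)))

end IsFermiData

/-! ### The approximation in coordinates -/

namespace IsFermiData

variable {m : ℕ} {g L : EuclideanSpace ℝ (Fin (m + 1)) → Matrix (Fin (m + 1)) (Fin (m + 1)) ℝ}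
  {Ω : Set (EuclideanSpace ℝ (Fin (m + 1)))} {x : EuclideanSpace ℝ (Fin (m + 1))}

theorem riemann_swap (h : IsFermiData Ω g L) (hx : x ∈ Ω) (i j k l : Fin (m + 1)) :
    riemann g x i j k l = riemann g x k l i j := by
  rw [riemann_eq_curvForm (h.metric_symm x hx), riemann_eq_curvForm (h.metric_symm x hx)]
  exact curvForm_swap (h.inv_symm hx) (h.domain.pd_symm h.metric_symm hx)
    (h.domain.pd_pd_symm h.metric_symm hx)
    (fun k i j l => h.domain.pd_pd_comm (h.metric_smooth j l) hx i k) i j k l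

/-- The curvature tensor of the modified metric has the pair symmetry also where the modified
metric is degenerate. -/
theorem riemann_modifiedMetric_swap (h : IsFermiData Ω g L) (C : ℝ) {f : ℝ → ℝ} {f' : ℝ}
    (hf : ContinuousOn f (Ici 0)) (hx : x ∈ Ω) (hf' : HasDerivWithinAt f f' (Ici 0) (x 0))
    (i j k l : Fin (m + 1)) : riemann (modifiedMetric g L C f) x i j k l =
      riemann (modifiedMetric g L C f) x k l i j := by
  have hs := h.isSymm_modifiedMetric C f hx
  have hs' : ((modifiedMetric g L C f x)⁻¹).IsSymm := by
    rw [Matrix.IsSymm, Matrix.transpose_nonsing_inv, hs.eq]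
  rw [riemann_eq_curvForm hs, riemann_eq_curvForm hs]
  refine curvForm_swap hs' (h.domain.pd_symm (fun y hy => h.isSymm_modifiedMetric C f hy) hx)
    (h.domain.pd_pd_symm (fun y hy => h.isSymm_modifiedMetric C f hy) hx) (fun k i j l => ?_)
    i j k l
  simp only [h.pd_pd_modifiedMetric C hf hx hf']
  unfold jet₂
  rw [h.domain.pd_pd_comm (h.metric_smooth j l) hx i k,
    h.domain.pd_pd_comm (h.contDiffOn_form j l) hx i k,
    h.domain.pd_pd_comm (h.contDiffOn_formT j l) hx i k]
  ring

theorem expansionTensor_swap (h : IsFermiData Ω g L) (C u u' : ℝ) (hx : x ∈ Ω)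
    (i j k l : Fin (m + 1)) :
    expansionTensor g L C u u' x i j k l = expansionTensor g L C u u' x k l i j := by
  have hcod : codazziTensor g L x i j k l = codazziTensor g L x k l i j := by
    unfold codazziTensor
    ring
  unfold expansionTensor
  rw [h.riemann_swap hx, hcod, knTensor_swap (h.op_symm x hx) (h.op_symm x hx),
    knTensor_swap (h.op_symm x hx) (h.isSymm_nablaN hx),
    knTensor_swap (h.op_symm x hx) (h.isSymm_projN hx),
    knTensor_swap (h.isSymm_sq hx) (h.isSymm_projN hx),
    knTensor_swap (h.isSymm_projT hx) (h.isSymm_projN hx)]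

/-- The eigenvalues are bounded by a function of the point and of the values of `f_δ`, `F_δ`, `ℱ_δ`
which is continuous and zero where the last two vanish; these tend to zero uniformly, while `f_δ`
stays in `[-1, 1]`. -/
theorem operatorApprox (h : IsFermiData Ω g L) {δmax : ℝ} (hδmax : 0 < δmax) {f : ℝ → ℝ → ℝ}
    (hf : IsAuxFamily δmax f) (C : ℝ) :
    OperatorApprox δmax g Ω (fun δ x => opOf (g x) (riemann (modifiedMetric g L C (f δ)) x))
      (fun δ x => curvatureExpansion g L C (f δ) x) := by
  have hdiff : ∀ δ ∈ Ioo 0 δmax, ∀ x ∈ Ω,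
      opOf (g x) (riemann (modifiedMetric g L C (f δ)) x) - curvatureExpansion g L C (f δ) x =
        opOf (g x) (remainder g L C (f δ (x 0)) (primitive (f δ) (x 0))
          (primitive (primitive (f δ)) (x 0)) x) := by
    intro δ hδ x hx
    rw [curvatureExpansion_eq_opOf g L C (f δ) (h.metric_det x hx), ← opOf_sub,
      h.riemann_modifiedMetric_sub C (hf.continuousOn hδ) hx
        (hf.hasDerivWithinAt hδ (h.domain.subset hx))]
  refine ⟨fun δ hδ x hx => ⟨?_, ?_⟩, fun δ hδ x hx hx0 => ?_, fun K hK hKc ε hε => ?_⟩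
  · exact isSelfAdjointFor_opOf (h.metric_symm x hx) (h.metric_det x hx)
      (h.riemann_modifiedMetric_swap C (hf.continuousOn hδ) hx
        (hf.hasDerivWithinAt hδ (h.domain.subset hx)))
  · dsimp only
    rw [curvatureExpansion_eq_opOf g L C (f δ) (h.metric_det x hx)]
    exact isSelfAdjointFor_opOf (h.metric_symm x hx) (h.metric_det x hx)
      (h.expansionTensor_swap C _ _ hx)
  · rw [← sub_eq_zero, hdiff δ hδ x hx, hx0, primitive_zero, primitive_zero,
      h.remainder_zero C _ hx, opOf_zero]
  · set Φ : (ℝ × ℝ) × (EuclideanSpace ℝ (Fin (m + 1)) × ℝ) → ℝ := fun z =>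
      ∑ i, ∑ j, ∑ k, ∑ l,
        |opCoeff (g z.2.1)⁻¹ (remainder g L C z.2.2 z.1.1 z.1.2 z.2.1) i j k l| with hΦ
    have hΦ0 : ∀ x ∈ Ω, ∀ u, Φ ((0, 0), (x, u)) = 0 := by
      intro x hx u
      simp [hΦ, h.remainder_zero C u hx, opCoeff]
    have hev : ∀ᶠ p : ℝ × ℝ in nhds (0, 0), ∀ q ∈ K ×ˢ Icc (-1 : ℝ) 1,
        q.1 ∈ Ω → Φ (p, q) < ε := by
      refine (hKc.prod isCompact_Icc).eventually_forall_of_forall_eventually ?_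
      rintro ⟨x, u⟩ ⟨hxK, -⟩
      have hc : ContinuousWithinAt Φ {z | z.2.1 ∈ Ω} ((0, 0), (x, u)) :=
        tendsto_finsetSum _ fun i _ => tendsto_finsetSum _ fun j _ =>
          tendsto_finsetSum _ fun k _ => tendsto_finsetSum _ fun l _ =>
            (h.continuousWithinAt_opCoeff_remainder C (hK hxK) u i j k l).abs
      have hlt : Φ ((0, 0), (x, u)) < ε := by rwa [hΦ0 x (hK hxK)]
      exact eventually_nhdsWithin_iff.mp (hc.eventually_lt_const hlt)
    obtain ⟨η, hη, hball⟩ := Metric.eventually_nhds_iff.mp hev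
    refine ⟨min δmax (min 1 η), lt_min hδmax (lt_min one_pos hη), min_le_left _ _,
      fun δ hδ x hxK μ hμ => ?_⟩
    have hδ' : δ ∈ Ioo 0 δmax := ⟨hδ.1, hδ.2.trans_le (min_le_left _ _)⟩
    have hδ1 : δ ≤ 1 := hδ.2.le.trans ((min_le_right _ _).trans (min_le_left _ _))
    have hδη : δ < η := hδ.2.trans_le ((min_le_right _ _).trans (min_le_right _ _))
    have hx0 : 0 ≤ x 0 := h.domain.subset (hK hxK)
    have hμ' := hμ
    rw [hdiff δ hδ' x (hK hxK)] at hμ'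
    refine (abs_eigenvalue_opOf_le _ _ hμ').trans_lt ?_
    refine hball (y := (primitive (f δ) (x 0), primitive (primitive (f δ)) (x 0))) ?_
      (x, f δ (x 0)) ⟨hxK, abs_le.mp (hf.abs_le_one hδ' hδ1 hx0)⟩ (hK hxK)
    rw [Prod.dist_eq]
    simp only [dist_zero_right, Real.norm_eq_abs]
    exact max_lt ((hf.abs_primitive_le hδ' hδ1 hx0).trans_lt hδη)
      ((hf.abs_primitive_primitive_le hδ' hδ1 hx0).trans_lt hδη)

end IsFermiData

/-! ### Coefficients in a chart -/

section Chart

variable {m : ℕ} {M : Type*} [TopologicalSpace M]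
  {e : OpenPartialHomeomorph M (EuclideanHalfSpace (m + 1))}
  {x : EuclideanSpace ℝ (Fin (m + 1))}

theorem isHalfSpaceDomain_extend_target
    (e : OpenPartialHomeomorph M (EuclideanHalfSpace (m + 1))) :
    IsHalfSpaceDomain (e.extend (𝓡∂ (m + 1))).target where
  subset := by
    rw [halfSpace_eq_range]
    exact e.extend_target_subset_range
  mem_nhdsWithin x hx := by
    have h := e.extend_target_mem_nhdsWithin (I := 𝓡∂ (m + 1))
      (y := (e.extend (𝓡∂ (m + 1))).symm x) (by
        rw [← e.extend_source (I := 𝓡∂ (m + 1))]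
        exact (e.extend (𝓡∂ (m + 1))).map_target hx)
    rwa [(e.extend (𝓡∂ (m + 1))).right_inv hx, ← halfSpace_eq_range] at h

theorem symm_mem_source (hx : x ∈ (e.extend (𝓡∂ (m + 1))).target) :
    (e.extend (𝓡∂ (m + 1))).symm x ∈ e.source := by
  rw [← e.extend_source (I := 𝓡∂ (m + 1))]
  exact (e.extend (𝓡∂ (m + 1))).map_target hx

variable [ChartedSpace (EuclideanHalfSpace (m + 1)) M]

theorem contMDiffOn_symm (he : e ∈ IsManifold.maximalAtlas (𝓡∂ (m + 1)) ∞ M) :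
    ContMDiffOn 𝓘(ℝ, EuclideanSpace ℝ (Fin (m + 1))) (𝓡∂ (m + 1)) ∞
      (e.extend (𝓡∂ (m + 1))).symm (e.extend (𝓡∂ (m + 1))).target := by
  have h := contMDiffOn_extend_symm he
  rwa [(𝓡∂ (m + 1)).image_eq, ← e.extend_target] at h

theorem mdifferentiableWithinAt_symm (he : e ∈ IsManifold.maximalAtlas (𝓡∂ (m + 1)) ∞ M)
    (hx : x ∈ (e.extend (𝓡∂ (m + 1))).target) :
    MDifferentiableWithinAt 𝓘(ℝ, EuclideanSpace ℝ (Fin (m + 1))) (𝓡∂ (m + 1))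
      (e.extend (𝓡∂ (m + 1))).symm (halfSpace m) x :=
  ((contMDiffOn_symm he x hx).mdifferentiableWithinAt (by simp)).mono_of_mem_nhdsWithin
    ((isHalfSpaceDomain_extend_target e).mem_nhdsWithin x hx)

/-- The components of `∑ᵢ vⁱ ∂ᵢ` are the `vⁱ`. -/
theorem coordComp_mfderivWithin_symm [IsManifold (𝓡∂ (m + 1)) ∞ M]
    (he : e ∈ IsManifold.maximalAtlas (𝓡∂ (m + 1)) ∞ M)
    (hx : x ∈ (e.extend (𝓡∂ (m + 1))).target) (v : EuclideanSpace ℝ (Fin (m + 1))) :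
    coordComp e ((e.extend (𝓡∂ (m + 1))).symm x)
      (mfderivWithin 𝓘(ℝ, EuclideanSpace ℝ (Fin (m + 1))) (𝓡∂ (m + 1))
        (e.extend (𝓡∂ (m + 1))).symm (halfSpace m) x v) = v := by
  have hΩ := isHalfSpaceDomain_extend_target e
  have hu : UniqueMDiffWithinAt 𝓘(ℝ, EuclideanSpace ℝ (Fin (m + 1))) (halfSpace m) x :=
    (uniqueDiffOn_halfSpace m x (hΩ.subset hx)).uniqueMDiffWithinAt
  have h1 : MDifferentiableAt (𝓡∂ (m + 1)) 𝓘(ℝ, EuclideanSpace ℝ (Fin (m + 1)))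
      (e.extend (𝓡∂ (m + 1))) ((e.extend (𝓡∂ (m + 1))).symm x) :=
    (e.contMDiffAt_extend he (symm_mem_source hx)).mdifferentiableAt (by simp)
  have h2 := mfderiv_comp_mfderivWithin x h1 (mdifferentiableWithinAt_symm he hx) hu
  have h3 : mfderivWithin 𝓘(ℝ, EuclideanSpace ℝ (Fin (m + 1)))
      𝓘(ℝ, EuclideanSpace ℝ (Fin (m + 1)))
      (e.extend (𝓡∂ (m + 1)) ∘ (e.extend (𝓡∂ (m + 1))).symm) (halfSpace m) x =
      mfderivWithin 𝓘(ℝ, EuclideanSpace ℝ (Fin (m + 1)))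
        𝓘(ℝ, EuclideanSpace ℝ (Fin (m + 1))) id (halfSpace m) x :=
    Filter.EventuallyEq.mfderivWithin_eq
      (Filter.eventuallyEq_of_mem (hΩ.mem_nhdsWithin x hx)
        fun y hy => (e.extend (𝓡∂ (m + 1))).right_inv hy)
      ((e.extend (𝓡∂ (m + 1))).right_inv hx)
  rw [h3, mfderivWithin_id hu] at h2
  exact (DFunLike.congr_fun h2 v).symm

/-- The inverse of the differential of the chart. -/
noncomputable def coordMap (e : OpenPartialHomeomorph M (EuclideanHalfSpace (m + 1)))
    (x : EuclideanSpace ℝ (Fin (m + 1))) : EuclideanSpace ℝ (Fin (m + 1)) →L[ℝ]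
      TangentSpace (𝓡∂ (m + 1)) ((e.extend (𝓡∂ (m + 1))).symm x) :=
  mfderivWithin 𝓘(ℝ, EuclideanSpace ℝ (Fin (m + 1))) (𝓡∂ (m + 1))
    (e.extend (𝓡∂ (m + 1))).symm (halfSpace m) x

theorem coordMap_single (x : EuclideanSpace ℝ (Fin (m + 1))) (i : Fin (m + 1)) :
    coordMap e x (EuclideanSpace.single i 1) = coordVec e x i := rfl

theorem coordMap_eq_sum (x v : EuclideanSpace ℝ (Fin (m + 1))) :
    coordMap e x v = ∑ i, v i • coordVec e x i := by
  conv_lhs => rw [← (EuclideanSpace.basisFun (Fin (m + 1)) ℝ).sum_repr v]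
  rw [map_sum]
  refine Finset.sum_congr rfl fun i _ => ?_
  rw [map_smul, EuclideanSpace.basisFun_apply, coordMap_single]
  rfl

theorem coordMap_coordComp [IsManifold (𝓡∂ (m + 1)) ∞ M]
    (he : e ∈ IsManifold.maximalAtlas (𝓡∂ (m + 1)) ∞ M)
    (hx : x ∈ (e.extend (𝓡∂ (m + 1))).target)
    (v : TangentSpace (𝓡∂ (m + 1)) ((e.extend (𝓡∂ (m + 1))).symm x)) :
    coordMap e x (coordComp e _ v) = v := by
  have hinj : Function.Injective (coordMap e x) :=
    Function.LeftInverse.injective (coordComp_mfderivWithin_symm he hx)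
  have hsurj : Function.Surjective (coordMap e x) :=
    (LinearMap.injective_iff_surjective (K := ℝ) (V := EuclideanSpace ℝ (Fin (m + 1)))
      (f := (coordMap e x).toLinearMap)).mp hinj
  obtain ⟨w, rfl⟩ := hsurj v
  exact congrArg _ (coordComp_mfderivWithin_symm he hx w)

variable [RiemannianBundle (fun p : M => TangentSpace (𝓡∂ (m + 1)) p)]

theorem isSymm_metricCoeff (x : EuclideanSpace ℝ (Fin (m + 1))) : (metricCoeff e x).IsSymm := by
  ext i j
  simp only [metricCoeff, Matrix.transpose_apply, Matrix.of_apply]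
  exact real_inner_comm _ _

theorem det_metricCoeff_ne_zero [IsManifold (𝓡∂ (m + 1)) ∞ M]
    (he : e ∈ IsManifold.maximalAtlas (𝓡∂ (m + 1)) ∞ M)
    (hx : x ∈ (e.extend (𝓡∂ (m + 1))).target) : (metricCoeff e x).det ≠ 0 := by
  intro hdet
  obtain ⟨v, hv0, hv⟩ := Matrix.exists_mulVec_eq_zero_iff.mpr hdet
  have h1 : ∀ i, inner ℝ (coordVec e x i) (coordMap e x (WithLp.toLp 2 v)) = 0 := by
    intro i
    have hvi := congrFun hv i
    simp only [Matrix.mulVec, dotProduct, metricCoeff, Matrix.of_apply, Pi.zero_apply] at hvi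
    rw [coordMap_eq_sum, inner_sum, ← hvi]
    simp only [inner_smul_right]
    exact Finset.sum_congr rfl fun j _ => mul_comm _ _
  have h2 : inner ℝ (coordMap e x (WithLp.toLp 2 v)) (coordMap e x (WithLp.toLp 2 v)) = 0 := by
    conv_lhs => rw [coordMap_eq_sum, sum_inner]
    refine Finset.sum_eq_zero fun i _ => ?_
    rw [inner_smul_left, ← coordMap_eq_sum, h1, mul_zero]
  have h3 : coordMap e x (WithLp.toLp 2 v) = 0 := inner_self_eq_zero.mp h2
  have h4 := coordComp_mfderivWithin_symm he hx (WithLp.toLp 2 v)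
  rw [show mfderivWithin 𝓘(ℝ, EuclideanSpace ℝ (Fin (m + 1))) (𝓡∂ (m + 1))
    (e.extend (𝓡∂ (m + 1))).symm (halfSpace m) x (WithLp.toLp 2 v) = 0 from h3, coordComp,
    map_zero] at h4
  exact hv0 (funext fun i => (congrFun (congrArg WithLp.ofLp h4) i).symm)

/-- The form `g 𝐀` has the coefficients `⟨∂ᵢ, 𝐀 ∂ⱼ⟩`. -/
theorem metricCoeff_mul_endCoeff [IsManifold (𝓡∂ (m + 1)) ∞ M]
    (he : e ∈ IsManifold.maximalAtlas (𝓡∂ (m + 1)) ∞ M)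
    (hx : x ∈ (e.extend (𝓡∂ (m + 1))).target)
    (A : ∀ p : M, TangentSpace (𝓡∂ (m + 1)) p →L[ℝ] TangentSpace (𝓡∂ (m + 1)) p)
    (i j : Fin (m + 1)) : (metricCoeff e x * endCoeff e A x) i j =
      inner ℝ (coordVec e x i) (A ((e.extend (𝓡∂ (m + 1))).symm x) (coordVec e x j)) := by
  conv_rhs => rw [← coordMap_coordComp he hx (A _ (coordVec e x j)), coordMap_eq_sum, inner_sum]
  simp only [Matrix.mul_apply, metricCoeff, endCoeff, Matrix.of_apply, inner_smul_right]
  exact Finset.sum_congr rfl fun k _ => mul_comm _ _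

theorem contDiffOn_metricCoeff [IsManifold (𝓡∂ (m + 1)) ∞ M]
    [IsContMDiffRiemannianBundle (𝓡∂ (m + 1)) ∞ (EuclideanSpace ℝ (Fin (m + 1)))
      (fun p : M => TangentSpace (𝓡∂ (m + 1)) p)]
    (he : e ∈ IsManifold.maximalAtlas (𝓡∂ (m + 1)) ∞ M) (i j : Fin (m + 1)) :
    ContDiffOn ℝ ∞ (fun x => metricCoeff e x i j) (e.extend (𝓡∂ (m + 1))).target := by
  set Ω := (e.extend (𝓡∂ (m + 1))).target
  have hΩ : IsHalfSpaceDomain Ω := isHalfSpaceDomain_extend_target e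
  have huΩ : ∀ x ∈ Ω, UniqueDiffWithinAt ℝ Ω x := fun x hx =>
    (uniqueDiffOn_halfSpace m x (hΩ.subset hx)).mono_nhds (by
      rw [nhdsWithin_le_iff]; exact hΩ.mem_nhdsWithin x hx)
  have hu : UniqueMDiffOn 𝓘(ℝ, EuclideanSpace ℝ (Fin (m + 1))) Ω := fun x hx =>
    (huΩ x hx).uniqueMDiffWithinAt
  have : IsManifold (𝓡∂ (m + 1)) 1 M := IsManifold.of_le (n := ∞) (by simp)
  have hT := (contMDiffOn_symm he).contMDiffOn_tangentMapWithin (m := ∞) (by simp) hu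
  have hsec : ∀ i : Fin (m + 1), ContMDiffOn 𝓘(ℝ, EuclideanSpace ℝ (Fin (m + 1)))
      (𝓡∂ (m + 1)).tangent ∞
      (fun x => (⟨(e.extend (𝓡∂ (m + 1))).symm x, coordVec e x i⟩ :
        TangentBundle (𝓡∂ (m + 1)) M)) Ω := by
    intro i
    have hcst : ContMDiffOn 𝓘(ℝ, EuclideanSpace ℝ (Fin (m + 1)))
        (𝓘(ℝ, EuclideanSpace ℝ (Fin (m + 1)))).tangent ∞
        (fun x => (⟨x, EuclideanSpace.single i (1 : ℝ)⟩ :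
          TangentBundle 𝓘(ℝ, EuclideanSpace ℝ (Fin (m + 1))) (EuclideanSpace ℝ (Fin (m + 1))))) Ω :=
      contMDiffOn_vectorSpace_iff_contDiffOn.mpr contDiffOn_const
    refine (hT.comp hcst fun x hx => hx).congr fun x hx => ?_
    have hd := (mdifferentiableWithinAt_symm he hx).mfderivWithin_mono
      (huΩ x hx).uniqueMDiffWithinAt hΩ.subset
    simp only [Function.comp_apply, tangentMapWithin, coordVec, ← hd]
    rfl
  exact contMDiffOn_iff_contDiffOn.mp ((hsec i).inner_bundle (hsec j))

end Chart

/-! ### Fermi coordinates -/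

theorem hasDerivWithinAt_comp_consPt {m : ℕ} {u : EuclideanSpace ℝ (Fin (m + 1)) → ℝ}
    {y : EuclideanSpace ℝ (Fin m)} {t : ℝ} (ht : 0 ≤ t)
    (hu : DifferentiableWithinAt ℝ u (halfSpace m) (consPt t y)) :
    HasDerivWithinAt (fun s => u (consPt s y)) (pd 0 u (consPt t y)) (Ici t) t := by
  have hline : ∀ s, consPt s y = consPt 0 y + s • EuclideanSpace.single 0 (1 : ℝ) := by
    intro s
    ext i
    refine Fin.cases ?_ (fun i => ?_) i <;> simp [consPt]
  have h1 : HasDerivWithinAt (fun s => consPt s y) (EuclideanSpace.single 0 (1 : ℝ)) (Ici t) t := by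
    have h2 : HasDerivAt (fun s : ℝ => consPt 0 y + s •
        (EuclideanSpace.single 0 (1 : ℝ) : EuclideanSpace ℝ (Fin (m + 1))))
        ((1 : ℝ) • EuclideanSpace.single 0 (1 : ℝ)) t :=
      ((hasDerivAt_id t).smul_const _).const_add _
    rw [one_smul, ← funext hline] at h2
    exact h2.hasDerivWithinAt
  exact hu.hasFDerivWithinAt.comp_hasDerivWithinAt t h1 fun s hs => by
    simpa [halfSpace, consPt] using ht.trans hs

theorem consPt_tailPt {m : ℕ} (x : EuclideanSpace ℝ (Fin (m + 1))) :
    consPt (x 0) (tailPt x) = x := by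
  ext i
  refine Fin.cases ?_ (fun i => ?_) i <;> simp [consPt, tailPt]

/-- Gauss's lemma: along unit speed geodesics `x⁰ ↦ (x⁰, y)` the products `⟨∂₀, ∂ᵢ⟩` are constant,
since `∂₀ ⟨∂₀, ∂ᵢ⟩ = ⟨∇₀ ∂₀, ∂ᵢ⟩ + ½ ∂ᵢ ⟨∂₀, ∂₀⟩ = 0`. -/
theorem metric_normal_of_geodesic {m : ℕ} {Ω : Set (EuclideanSpace ℝ (Fin (m + 1)))}
    {g : EuclideanSpace ℝ (Fin (m + 1)) → Matrix (Fin (m + 1)) (Fin (m + 1)) ℝ}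
    (hΩ : IsHalfSpaceDomain Ω) (hg : ∀ i j, ContDiffOn ℝ ∞ (fun x => g x i j) Ω)
    (hsymm : ∀ x ∈ Ω, (g x).IsSymm) (hdet : ∀ x ∈ Ω, (g x).det ≠ 0)
    (segment : ∀ x ∈ Ω, ∀ t ∈ Icc 0 (x 0), consPt t (tailPt x) ∈ Ω)
    (unitSpeed : ∀ x ∈ Ω, g x 0 0 = 1) (geodesic : ∀ x ∈ Ω, ∀ k, christoffel g x k 0 0 = 0)
    (orthogonal : ∀ x ∈ Ω, x 0 = 0 → ∀ i : Fin m, g x 0 i.succ = 0) :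
    ∀ x ∈ Ω, ∀ i, g x i 0 = conormal m i := by
  have hpd : ∀ x ∈ Ω, ∀ l, pd 0 (fun y => g y 0 l) x = 0 := by
    intro x hx l
    have h1 := sum_mul_christoffel (hdet x hx) l 0 0
    have h2 : pd l (fun y => g y 0 0) x = 0 := by
      rw [pd_congr (hΩ.mem_nhdsWithin x hx) hx unitSpeed, pd_const]
    simp only [geodesic x hx, mul_zero, Finset.sum_const_zero, lowerChristoffel, h2] at h1
    linarith
  intro x hx i
  refine Fin.cases ?_ (fun i => ?_) i
  · simp [unitSpeed x hx, conormal]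
  · have hx0 : 0 ≤ x 0 := hΩ.subset hx
    have hd : ∀ t ∈ Icc 0 (x 0), HasDerivWithinAt (fun s => g (consPt s (tailPt x)) 0 i.succ) 0
        (Ici t) t := by
      intro t ht
      have hmem := segment x hx t ht
      have h1 := hasDerivWithinAt_comp_consPt ht.1
        (hΩ.differentiableWithinAt (hg 0 i.succ) hmem)
      rwa [hpd _ hmem] at h1
    have hc : ContinuousOn (fun s => g (consPt s (tailPt x)) 0 i.succ) (Icc 0 (x 0)) := by
      have hcons : Continuous fun s : ℝ => consPt s (tailPt x) := by
        refine (PiLp.continuous_toLp 2 _).comp (continuous_pi fun j => ?_)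
        refine Fin.cases ?_ (fun j => ?_) j
        · exact continuous_id
        · exact continuous_const
      exact (hg 0 i.succ).continuousOn.comp hcons.continuousOn fun t ht => segment x hx t ht
    have hconst := constant_of_has_deriv_right_zero hc (fun t ht => hd t ⟨ht.1, ht.2.le⟩) (x 0)
      ⟨hx0, le_rfl⟩
    have h0 : g (consPt 0 (tailPt x)) 0 i.succ = 0 :=
      orthogonal _ (segment x hx 0 ⟨le_rfl, hx0⟩) (by simp [consPt]) i
    rw [consPt_tailPt, h0, (hsymm x hx).apply i.succ 0] at hconst
    simp [hconst, conormal]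

theorem IsFermiChart.isFermiData {m : ℕ} {Γ M : Type*} [TopologicalSpace Γ]
    [ChartedSpace (EuclideanSpace ℝ (Fin m)) Γ]
    [EMetricSpace M] [ChartedSpace (EuclideanHalfSpace (m + 1)) M]
    [IsManifold (𝓡∂ (m + 1)) ∞ M]
    [RiemannianBundle (fun p : M => TangentSpace (𝓡∂ (m + 1)) p)]
    [IsContMDiffRiemannianBundle (𝓡∂ (m + 1)) ∞ (EuclideanSpace ℝ (Fin (m + 1)))
      (fun p : M => TangentSpace (𝓡∂ (m + 1)) p)]
    {ι : Γ → M} {c : OpenPartialHomeomorph Γ (EuclideanSpace ℝ (Fin m))}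
    {e : OpenPartialHomeomorph M (EuclideanHalfSpace (m + 1))} (he : IsFermiChart ι c e)
    {L : ∀ p : M, TangentSpace (𝓡∂ (m + 1)) p →L[ℝ] TangentSpace (𝓡∂ (m + 1)) p}
    (hsa : ∀ p ∈ e.source, ∀ v w : TangentSpace (𝓡∂ (m + 1)) p,
      inner ℝ (L p v) w = inner ℝ v (L p w))
    (hsmooth : ∀ i j, ContDiffOn ℝ ∞ (fun x => endCoeff e L x i j)
      (e.extend (𝓡∂ (m + 1))).target)
    (hnormal : ∀ x ∈ (e.extend (𝓡∂ (m + 1))).target, ∀ k, endCoeff e L x k 0 = 0) :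
    IsFermiData (e.extend (𝓡∂ (m + 1))).target (metricCoeff e) (endCoeff e L) where
  domain := isHalfSpaceDomain_extend_target e
  metric_smooth := contDiffOn_metricCoeff he.chart_mem
  op_smooth := hsmooth
  metric_symm _ _ := isSymm_metricCoeff _
  metric_det _ hx := det_metricCoeff_ne_zero he.chart_mem hx
  metric_normal := metric_normal_of_geodesic (isHalfSpaceDomain_extend_target e)
    (contDiffOn_metricCoeff he.chart_mem) (fun _ _ => isSymm_metricCoeff _)
    (fun _ hx => det_metricCoeff_ne_zero he.chart_mem hx) he.segment he.unitSpeed he.geodesic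
    he.orthogonal
  op_symm x hx := by
    ext i j
    rw [Matrix.transpose_apply, metricCoeff_mul_endCoeff he.chart_mem hx,
      metricCoeff_mul_endCoeff he.chart_mem hx, ← hsa _ (symm_mem_source hx), real_inner_comm]
  op_normal := hnormal

end Gluing

theorem mainTheorem7 {m : ℕ} {Γ M₀ M₁ : Type*}
    [TopologicalSpace Γ] [CompactSpace Γ] [ChartedSpace (EuclideanSpace ℝ (Fin m)) Γ]
    [IsManifold (𝓡 m) ∞ Γ]
    [EMetricSpace M₀] [ChartedSpace (EuclideanHalfSpace (m + 1)) M₀]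
    [IsManifold (𝓡∂ (m + 1)) ∞ M₀]
    [RiemannianBundle (fun p : M₀ => TangentSpace (𝓡∂ (m + 1)) p)]
    [IsContMDiffRiemannianBundle (𝓡∂ (m + 1)) ∞ (EuclideanSpace ℝ (Fin (m + 1)))
      (fun p : M₀ => TangentSpace (𝓡∂ (m + 1)) p)]
    [IsRiemannianManifold (𝓡∂ (m + 1)) M₀]
    [EMetricSpace M₁] [ChartedSpace (EuclideanHalfSpace (m + 1)) M₁]
    [IsManifold (𝓡∂ (m + 1)) ∞ M₁]
    [RiemannianBundle (fun p : M₁ => TangentSpace (𝓡∂ (m + 1)) p)]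
    [IsContMDiffRiemannianBundle (𝓡∂ (m + 1)) ∞ (EuclideanSpace ℝ (Fin (m + 1)))
      (fun p : M₁ => TangentSpace (𝓡∂ (m + 1)) p)]
    [IsRiemannianManifold (𝓡∂ (m + 1)) M₁]
    (ι₀ : Γ → M₀) (ι₁ : Γ → M₁)
    (hι₀ : IsSmoothEmbedding (𝓡 m) (𝓡∂ (m + 1)) ∞ ι₀)
    (hι₁ : IsSmoothEmbedding (𝓡 m) (𝓡∂ (m + 1)) ∞ ι₁)
    (hΓ₀ : range ι₀ = (𝓡∂ (m + 1)).boundary M₀)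
    (hΓ₁ : range ι₁ = (𝓡∂ (m + 1)).boundary M₁)
    (hiso : ∀ (q : Γ) (u v : TangentSpace (𝓡 m) q),
      inner ℝ (mfderiv (𝓡 m) (𝓡∂ (m + 1)) ι₀ q u) (mfderiv (𝓡 m) (𝓡∂ (m + 1)) ι₀ q v) =
        inner ℝ (mfderiv (𝓡 m) (𝓡∂ (m + 1)) ι₁ q u) (mfderiv (𝓡 m) (𝓡∂ (m + 1)) ι₁ q v))
    (U : Set M₀) (hU : IsOpen U) (hΓU : range ι₀ ⊆ U)
    (L : ∀ p : M₀, TangentSpace (𝓡∂ (m + 1)) p →L[ℝ] TangentSpace (𝓡∂ (m + 1)) p)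
    (hL : Gluing.IsGluingOperator ι₀ ι₁ U L)
    (δmax : ℝ) (hδmax : 0 < δmax) (f : ℝ → ℝ → ℝ) (hf : Gluing.IsAuxFamily δmax f) (C : ℝ)
    (c : OpenPartialHomeomorph Γ (EuclideanSpace ℝ (Fin m)))
    (e : OpenPartialHomeomorph M₀ (EuclideanHalfSpace (m + 1)))
    (he : Gluing.IsFermiChart ι₀ c e) (heU : e.source ⊆ U) :
    Gluing.OperatorApprox δmax (Gluing.metricCoeff e) (e.extend (𝓡∂ (m + 1))).target
      (fun δ x => Gluing.opOf (Gluing.metricCoeff e x)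
        (Gluing.riemann
          (Gluing.modifiedMetric (Gluing.metricCoeff e) (Gluing.endCoeff e L) C (f δ)) x))
      (fun δ x => Gluing.curvatureExpansion (Gluing.metricCoeff e) (Gluing.endCoeff e L) C (f δ) x) ∧
    ∀ (β : Gluing.TwoVector (m + 1)) (i j : Fin (m + 1)),
      ContDiffOn ℝ ∞
        (fun x => (Gluing.opB (Gluing.metricCoeff e) (Gluing.endCoeff e L) x β).1 i j)
        (e.extend (𝓡∂ (m + 1))).target := by
  have hdata : Gluing.IsFermiData (e.extend (𝓡∂ (m + 1))).target (Gluing.metricCoeff e)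
      (Gluing.endCoeff e L) :=
    he.isFermiData (fun p hp => hL.selfAdjoint p (heU hp)) (hL.smooth c e he heU)
      (hL.normal c e he heU)
  exact ⟨hdata.operatorApprox hδmax hf C, hdata.contDiffOn_opB⟩
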